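/- Let $(N^n,h)$ be a smooth Riemannian manifold without boundary, let $m\ge 0$, and let $f:\mathbb R^m\to N$ be a soliton, i.e. a smooth map from flat Euclidean space satisfying $$\tau(f)(x)=Tf_x\!\left(\tfrac{x}{2}\right)\qquad\text{for all }x\in\mathbb R^m,$$ where $Tf$ is the differential of $f$ and $\tau(f)=\operatorname{tr}(\nabla Tf)$ is the tension field of $f$, given in local coordinates by $\tau^k=\sum_{\alpha=1}^m\big(\partial_\alpha\partial_\alpha f^k+\sum_{i,j}\Gamma^k_{ij}(f)\,\partial_\alpha f^i\,\partial_\alpha f^j\big)$. Write $|Tf|^2(x)=\sum_{\alpha=1}^m h(\partial_\alpha f,\partial_\alpha f)(x)$. (1) Suppose that $K>0$, that all sectional curvatures of $N$ are bounded above by $K$, and that $K|Tf|^2\le 1$ on $\mathbb R^m$. Then $f$ is constant. (2) Suppose that all sectional curvatures of $N$ are nonpositive and that $f$ has polynomial energy growth, i.e. there is a polynomial $p$ with $\int_{B_r(0)}|Tf|^2\,dx\le p(r)$ for all $r\ge 0$. Then $f$ is constant. -/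

import Mathlib

open scoped Manifold ContDiff
open MeasureTheory

noncomputable section

namespace SolitonGap

/-- Euclidean space `ℝᵏ`. -/
abbrev Eu (k : ℕ) : Type := EuclideanSpace ℝ (Fin k)

/-- The `i`-th standard basis vector of `ℝᵏ`. -/
def stdVec {k : ℕ} (i : Fin k) : Eu k := EuclideanSpace.single i (1 : ℝ)

/-- The partial derivative `∂ᵢ u` of a real function on `ℝᵏ`. -/
def pd {k : ℕ} (i : Fin k) (u : Eu k → ℝ) (y : Eu k) : ℝ := fderiv ℝ u y (stdVec i)

/-- A smooth Riemannian metric on the `n`-dimensional manifold `N`. -/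
abbrev RMetric (n : ℕ) (N : Type*) [TopologicalSpace N] [ChartedSpace (Eu n) N]
    [IsManifold (𝓡 n) ∞ N] :=
  Bundle.ContMDiffRiemannianMetric (𝓡 n) ∞ (Eu n) (fun p : N => TangentSpace (𝓡 n) p)

variable {m n : ℕ} {N : Type*} [TopologicalSpace N] [ChartedSpace (Eu n) N]
  [IsManifold (𝓡 n) ∞ N]

/-! ### The target manifold in a coordinate chart `c`

A point of the chart domain is represented by its coordinate vector `y ∈ c.target`. -/

/-- The coordinate vector field `∂ᵢ` of the chart `c` at the point with coordinates `y`. -/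
def coordField (c : OpenPartialHomeomorph N (Eu n)) (i : Fin n) (y : Eu n) :
    TangentSpace (𝓡 n) (c.symm y) :=
  mfderiv (𝓡 n) (𝓡 n) c.symm y (stdVec i)

/-- The metric coefficients `h_{ij} = h(∂ᵢ, ∂ⱼ)`. -/
def metricCoeff (h : RMetric n N) (c : OpenPartialHomeomorph N (Eu n)) (i j : Fin n)
    (y : Eu n) : ℝ :=
  h.inner (c.symm y) (coordField c i y) (coordField c j y)

/-- The coefficients `h^{ij}` of the inverse matrix of `(h_{ij})`. -/
def invMetricCoeff (h : RMetric n N) (c : OpenPartialHomeomorph N (Eu n)) (i j : Fin n)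
    (y : Eu n) : ℝ :=
  (Matrix.of (fun a b => metricCoeff h c a b y))⁻¹ i j

/-- The connection coefficients of the Levi-Civita connection,
`Γᵏᵢⱼ = ½ ∑ₗ h^{kl} (∂ᵢ h_{jl} + ∂ⱼ h_{il} - ∂ₗ h_{ij})`, so that `∇ᵢ ∂ⱼ = ∑ₖ Γᵏᵢⱼ ∂ₖ`. -/
def christoffel (h : RMetric n N) (c : OpenPartialHomeomorph N (Eu n)) (k i j : Fin n)
    (y : Eu n) : ℝ :=
  (1 / 2 : ℝ) * ∑ l, invMetricCoeff h c k l y *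
    (pd i (metricCoeff h c j l) y + pd j (metricCoeff h c i l) y
      - pd l (metricCoeff h c i j) y)

/-- The components of the Riemann curvature tensor,
`R(∂ᵢ, ∂ⱼ) ∂ₖ = ∇ᵢ ∇ⱼ ∂ₖ - ∇ⱼ ∇ᵢ ∂ₖ = ∑ₗ (curvCoeff l i j k) ∂ₗ`. -/
def curvCoeff (h : RMetric n N) (c : OpenPartialHomeomorph N (Eu n)) (l i j k : Fin n)
    (y : Eu n) : ℝ :=
  pd i (christoffel h c l j k) y - pd j (christoffel h c l i k) y
    + ∑ p, (christoffel h c p j k y * christoffel h c l i p y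
      - christoffel h c p i k y * christoffel h c l j p y)

/-- The inner product `h(u, v)` of the tangent vectors with components `u` and `v`. -/
def innerCoord (h : RMetric n N) (c : OpenPartialHomeomorph N (Eu n)) (y : Eu n)
    (u v : Fin n → ℝ) : ℝ :=
  ∑ i, ∑ j, metricCoeff h c i j y * u i * v j

/-- The components of the vector `R(u, v) w`. -/
def curvCoord (h : RMetric n N) (c : OpenPartialHomeomorph N (Eu n)) (y : Eu n)
    (u v w : Fin n → ℝ) (l : Fin n) : ℝ :=
  ∑ i, ∑ j, ∑ k, curvCoeff h c l i j k y * u i * v j * w k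

/-- The sectional curvature `h(R(u, v) v, u) / (|u|² |v|² - h(u, v)²)` of the plane spanned by
the tangent vectors with components `u` and `v`. -/
def sectionalCurvature (h : RMetric n N) (c : OpenPartialHomeomorph N (Eu n)) (y : Eu n)
    (u v : Fin n → ℝ) : ℝ :=
  innerCoord h c y (curvCoord h c y u v v) u /
    (innerCoord h c y u u * innerCoord h c y v v - innerCoord h c y u v ^ 2)

/-- All sectional curvatures of `(N, h)` are at most `K`. -/
def SectionalCurvatureLE (h : RMetric n N) (K : ℝ) : Prop :=
  ∀ c ∈ atlas (Eu n) N, ∀ y ∈ c.target, ∀ u v : Fin n → ℝ,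
    LinearIndependent ℝ ![u, v] → sectionalCurvature h c y u v ≤ K

/-! ### Maps `f : ℝᵐ → N` -/

/-- `|Tf|²(x) = ∑_α h(∂_α f, ∂_α f)`, twice the energy density of `f`. -/
def normSqDifferential (h : RMetric n N) (f : Eu m → N) (x : Eu m) : ℝ :=
  ∑ α, h.inner (f x) (mfderiv (𝓡 m) (𝓡 n) f x (stdVec α))
    (mfderiv (𝓡 m) (𝓡 n) f x (stdVec α))

/-- The `k`-th coordinate function `fᵏ` of `f` in the chart `c` of `N`. -/
def coordMap (c : OpenPartialHomeomorph N (Eu n)) (f : Eu m → N) (k : Fin n) (x : Eu m) : ℝ :=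
  c (f x) k

/-- The `k`-th component in the chart `c` of the tension field `τ(f) = tr ∇Tf`:
`τᵏ = ∑_α (∂_α ∂_α fᵏ + ∑_{i,j} Γᵏᵢⱼ(f) ∂_α fⁱ ∂_α fʲ)`. -/
def tension (h : RMetric n N) (c : OpenPartialHomeomorph N (Eu n)) (f : Eu m → N) (k : Fin n)
    (x : Eu m) : ℝ :=
  ∑ α, (pd α (pd α (coordMap c f k)) x
    + ∑ i, ∑ j, christoffel h c k i j (c (f x)) *
        pd α (coordMap c f i) x * pd α (coordMap c f j) x)

/-- `f : ℝᵐ → N` is a soliton: it is smooth and `τ(f) = (x / 2) ⌟ Tf`, where the components of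
both sides are compared in every coordinate chart of `N`. -/
structure IsSoliton (h : RMetric n N) (f : Eu m → N) : Prop where
  smooth : ContMDiff (𝓡 m) (𝓡 n) ∞ f
  tension_eq : ∀ c ∈ atlas (Eu n) N, ∀ x : Eu m, f x ∈ c.source → ∀ k : Fin n,
    tension h c f k x = ∑ α, x α / 2 * pd α (coordMap c f k) x

/-- `f` has polynomial energy growth: `∫_{B_r} |Tf|² ≤ p(r)` for a polynomial `p`. -/
def PolynomialEnergyGrowth (h : RMetric n N) (f : Eu m → N) : Prop :=
  ∃ p : Polynomial ℝ, ∀ r : ℝ, 0 ≤ r →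
    ∫ x in Metric.ball (0 : Eu m) r, normSqDifferential h f x ≤ p.eval r

end SolitonGap

end

noncomputable section

namespace SolitonGap

open Filter Topology

/-! ### Calculus of partial derivatives -/

section PartialDerivatives

variable {k l : ℕ} {i : Fin k} {u v : Eu k → ℝ} {x : Eu k}

/-! Let `V = Tf(x/2)` and `φ = |V|²`, and let `L = Δ - ⟨x/2, ∇⟩` be the drift Laplacian, which is
symmetric for the Gaussian weight `e^{-|x|²/4}`. Differentiating the soliton equation and commuting
covariant derivatives gives the Bochner formula `Lφ = 2|∇V|² + 2φ + 2 ∑_β h(R(∂_β f, V) ∂_β f, V)`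
(`driftLaplacian_innerAlong_radialAlong`). A curvature bound `K ≥ 0` turns it into `Lφ ≥ 2φ(1 -
K|Tf|²) + 2K ∑_β h(V, ∂_β f)²` (`le_driftLaplacian_radialEnergy`), so `Lφ ≥ 0` as soon as `K|Tf|² ≤
1`.

Integrating `Lφ` against the Gaussian would give zero. The Gaussian is therefore cut off, and the
error is controlled by polynomial energy growth through `φ ≤ |x|²/4 · |Tf|²`; hence `Lφ = 0`
(`driftLaplacian_eq_zero`). If `K = 0`, the inequality now reads `2φ ≤ 0`. If `K > 0`, it makes `V`
orthogonal to every `∂_β f`, and `V` is a combination of these, so again `V = 0`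
(`radialEnergy_eq_zero`). Then `f` is constant on rays from the origin, and so constant
(`eq_of_radialEnergy_eq_zero`).

Statement (1) has bounded energy density, hence polynomial growth; statement (2) is the case `K =
0`. Both follow the same route. -/

lemma pd_const (i : Fin k) (a : ℝ) (x : Eu k) : pd i (fun _ => a) x = 0 := by
  simp [pd]

lemma pd_add (hu : DifferentiableAt ℝ u x) (hv : DifferentiableAt ℝ v x) :
    pd i (fun y => u y + v y) x = pd i u x + pd i v x := by
  simp [pd, fderiv_fun_add hu hv]

lemma pd_mul (hu : DifferentiableAt ℝ u x) (hv : DifferentiableAt ℝ v x) :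
    pd i (fun y => u y * v y) x = pd i u x * v x + u x * pd i v x := by
  simp [pd, fderiv_fun_mul hu hv]
  ring

lemma pd_sum {ι : Type*} {s : Finset ι} {w : ι → Eu k → ℝ}
    (hw : ∀ j ∈ s, DifferentiableAt ℝ (w j) x) :
    pd i (fun y => ∑ j ∈ s, w j y) x = ∑ j ∈ s, pd i (w j) x := by
  simp [pd, fderiv_fun_sum hw]

lemma pd_congr (huv : u =ᶠ[𝓝 x] v) : pd i u x = pd i v x := by
  simp [pd, huv.fderiv_eq]

lemma fderiv_eq_sum_pd (x : Eu k) (w : Eu k) :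
    fderiv ℝ u x w = ∑ i, w i * pd i u x := by
  have hw : w = ∑ i, w i • stdVec i := by
    ext j
    simp [stdVec, Pi.single_apply]
  conv_lhs => rw [hw]
  simp [pd]

lemma fderiv_component {F : Eu k → Eu l} (hF : DifferentiableAt ℝ F x) (w : Eu k) (j : Fin l) :
    fderiv ℝ (fun y => F y j) x w = fderiv ℝ F x w j := by
  have h := (((EuclideanSpace.proj (𝕜 := ℝ) j).hasFDerivAt (x := F x)).comp x hF.hasFDerivAt).fderiv
  simp only [Function.comp_def, PiLp.proj_apply] at h
  rw [h]
  simp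

lemma pd_comp {F : Eu k → Eu l} {w : Eu l → ℝ} (hw : DifferentiableAt ℝ w (F x))
    (hF : DifferentiableAt ℝ F x) :
    pd i (fun y => w (F y)) x = ∑ j, pd j w (F x) * pd i (fun y => F y j) x := by
  have h1 : fderiv ℝ (fun y => w (F y)) x = (fderiv ℝ w (F x)).comp (fderiv ℝ F x) :=
    fderiv_comp x hw hF
  simp only [pd, h1, ContinuousLinearMap.comp_apply, fderiv_component hF]
  rw [fderiv_eq_sum_pd]
  exact Finset.sum_congr rfl fun j _ => mul_comm _ _

lemma hasFDerivAt_coord (j : Fin k) (x : Eu k) :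
    HasFDerivAt (fun y : Eu k => y j) (EuclideanSpace.proj (𝕜 := ℝ) j) x :=
  (EuclideanSpace.proj (𝕜 := ℝ) j).hasFDerivAt

lemma differentiableAt_coord (j : Fin k) (x : Eu k) :
    DifferentiableAt ℝ (fun y : Eu k => y j) x :=
  (hasFDerivAt_coord j x).differentiableAt

lemma contDiff_coord {r : WithTop ℕ∞} (j : Fin k) : ContDiff ℝ r (fun y : Eu k => y j) :=
  (EuclideanSpace.proj (𝕜 := ℝ) j).contDiff

lemma pd_coord (i j : Fin k) (x : Eu k) :
    pd i (fun y => y j) x = if j = i then 1 else 0 := by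
  simp [pd, (hasFDerivAt_coord j x).fderiv, stdVec]

lemma contDiff_pd {r : WithTop ℕ∞} (hu : ContDiff ℝ (r + 1) u) (i : Fin k) :
    ContDiff ℝ r (pd i u) :=
  (hu.fderiv_right le_rfl).clm_apply contDiff_const

lemma contDiff_pd_infty (hu : ContDiff ℝ ∞ u) (i : Fin k) : ContDiff ℝ ∞ (pd i u) :=
  contDiff_pd (r := ∞) hu i

lemma pd_comm {s : Set (Eu k)} (hs : IsOpen s) (hx : x ∈ s) (hu : ContDiffOn ℝ ∞ u s)
    (i j : Fin k) : pd i (pd j u) x = pd j (pd i u) x := by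
  have hc : ContDiffAt ℝ ∞ u x := hu.contDiffAt (hs.mem_nhds hx)
  have hd : DifferentiableAt ℝ (fderiv ℝ u) x :=
    (hc.fderiv_right (m := ∞) (by rfl)).differentiableAt (by simp)
  have h1 : ∀ a b : Fin k, pd a (pd b u) x = fderiv ℝ (fderiv ℝ u) x (stdVec a) (stdVec b) := by
    intro a b
    have : pd b u = fun y => fderiv ℝ u y (stdVec b) := rfl
    rw [pd, this, fderiv_clm_apply hd (differentiableAt_const _)]
    simp
  rw [h1, h1]
  exact (hc.isSymmSndFDerivAt (by simp; exact WithTop.coe_le_coe.2 le_top)).eq _ _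

lemma contDiffOn_pd {s : Set (Eu k)} (hs : IsOpen s) (hu : ContDiffOn ℝ ∞ u s) (i : Fin k) :
    ContDiffOn ℝ ∞ (pd i u) s :=
  (hu.fderiv_of_isOpen hs (by simp)).clm_apply contDiffOn_const

end PartialDerivatives

/-! ### The drift Laplacian and a Liouville type theorem -/

section Liouville

variable {m : ℕ}

/-- The drift Laplacian `Δu - ⟨x / 2, ∇u⟩`. -/
def driftLaplacian (u : Eu m → ℝ) (x : Eu m) : ℝ :=
  ∑ α, (pd α (pd α u) x - x α / 2 * pd α u x)

/-- The formal adjoint `Δρ + div (ρ x / 2)` of the drift Laplacian. -/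
def driftAdjoint (ρ : Eu m → ℝ) (x : Eu m) : ℝ :=
  ∑ α, (pd α (pd α ρ) x + pd α (fun y => ρ y * (y α / 2)) x)

/-! ### Integration by parts for the drift Laplacian. -/

lemma hasCompactSupport_pd {u : Eu m → ℝ} (hc : HasCompactSupport u) (α : Fin m) :
    HasCompactSupport (pd α u) :=
  hc.fderiv_apply ℝ (stdVec α)

lemma integral_mul_pd {u v : Eu m → ℝ} (hu : ContDiff ℝ 1 u) (hv : ContDiff ℝ 1 v)
    (hc : HasCompactSupport u) (α : Fin m) :
    ∫ x, u x * pd α v x = - ∫ x, pd α u x * v x := by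
  have hu' : Continuous (pd α u) := (contDiff_pd (r := 0) (by simpa using hu) α).continuous
  have hv' : Continuous (pd α v) := (contDiff_pd (r := 0) (by simpa using hv) α).continuous
  refine integral_mul_fderiv_eq_neg_fderiv_mul_of_integrable ?_ ?_ ?_ ?_ ?_
  · exact (hu'.mul hv.continuous).integrable_of_hasCompactSupport
      ((hasCompactSupport_pd hc α).mul_right)
  · exact (hu.continuous.mul hv').integrable_of_hasCompactSupport hc.mul_right
  · exact (hu.continuous.mul hv.continuous).integrable_of_hasCompactSupport hc.mul_right
  · exact fun x _ => hu.differentiable (by simp) x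
  · exact fun x _ => hv.differentiable (by simp) x

/-- Two integrations by parts for the second-order term and one for the drift. Compact support of
`ρ` removes all boundary terms, so `φ` needs no decay. -/
lemma integral_mul_driftLaplacian {ρ φ : Eu m → ℝ} (hρ : ContDiff ℝ ∞ ρ) (hφ : ContDiff ℝ ∞ φ)
    (hc : HasCompactSupport ρ) :
    ∫ x, ρ x * driftLaplacian φ x = ∫ x, driftAdjoint ρ x * φ x := by
  have h1 : ∀ {w : Eu m → ℝ}, ContDiff ℝ ∞ w → ContDiff ℝ 1 w := fun h => h.of_le (by simp)
  have hx : ∀ α, ContDiff ℝ ∞ (fun y : Eu m => ρ y * (y α / 2)) := fun α =>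
    hρ.mul ((contDiff_coord α).div_const 2)
  have hcx : ∀ α, HasCompactSupport (fun y : Eu m => ρ y * (y α / 2)) := fun α => hc.mul_right
  have i1 : ∀ α, Integrable (fun x => ρ x * pd α (pd α φ) x) := fun α =>
    (hρ.continuous.mul (contDiff_pd_infty (contDiff_pd_infty hφ α) α).continuous
      ).integrable_of_hasCompactSupport hc.mul_right
  have i2 : ∀ α, Integrable (fun x : Eu m => ρ x * (x α / 2) * pd α φ x) := fun α =>
    ((hx α).continuous.mul (contDiff_pd_infty hφ α).continuous
      ).integrable_of_hasCompactSupport (hcx α).mul_right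
  have i3 : ∀ α, Integrable (fun x => pd α (pd α ρ) x * φ x) := fun α =>
    ((contDiff_pd_infty (contDiff_pd_infty hρ α) α).continuous.mul hφ.continuous
      ).integrable_of_hasCompactSupport
      ((hasCompactSupport_pd (hasCompactSupport_pd hc α) α).mul_right)
  have i4 : ∀ α, Integrable (fun x => pd α (fun y => ρ y * (y α / 2)) x * φ x) := fun α =>
    ((contDiff_pd_infty (hx α) α).continuous.mul hφ.continuous
      ).integrable_of_hasCompactSupport ((hasCompactSupport_pd (hcx α) α).mul_right)
  have e1 : ∀ x, ρ x * driftLaplacian φ x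
      = ∑ α, (ρ x * pd α (pd α φ) x - ρ x * (x α / 2) * pd α φ x) := fun x => by
    rw [driftLaplacian, Finset.mul_sum]
    exact Finset.sum_congr rfl fun α _ => by ring
  have e2 : ∀ x, driftAdjoint ρ x * φ x
      = ∑ α, (pd α (pd α ρ) x * φ x + pd α (fun y => ρ y * (y α / 2)) x * φ x) := fun x => by
    rw [driftAdjoint, Finset.sum_mul]
    exact Finset.sum_congr rfl fun α _ => by ring
  simp only [e1, e2]
  have e3 : ∫ x, ∑ α, (ρ x * pd α (pd α φ) x - ρ x * (x α / 2) * pd α φ x)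
      = ∑ α, ∫ x, (ρ x * pd α (pd α φ) x - ρ x * (x α / 2) * pd α φ x) :=
    integral_finsetSum _ fun α _ => (i1 α).sub (i2 α)
  have e4 : ∫ x, ∑ α, (pd α (pd α ρ) x * φ x + pd α (fun y => ρ y * (y α / 2)) x * φ x)
      = ∑ α, ∫ x, (pd α (pd α ρ) x * φ x + pd α (fun y => ρ y * (y α / 2)) x * φ x) :=
    integral_finsetSum _ fun α _ => (i3 α).add (i4 α)
  rw [e3, e4]
  refine Finset.sum_congr rfl fun α _ => ?_
  rw [integral_sub (i1 α) (i2 α), integral_add (i3 α) (i4 α),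
    integral_mul_pd (h1 hρ) (h1 (contDiff_pd_infty hφ α)) hc,
    integral_mul_pd (h1 (contDiff_pd_infty hρ α)) (h1 hφ) (hasCompactSupport_pd hc α),
    integral_mul_pd (h1 (hx α)) (h1 hφ) (hcx α)]
  ring

lemma pd_radial {k : ℝ → ℝ} {k' : ℝ} {x : Eu m} (hk : HasDerivAt k k' (‖x‖ ^ 2)) (α : Fin m) :
    pd α (fun y => k (‖y‖ ^ 2)) x = 2 * x α * k' := by
  have h1 : HasFDerivAt (fun y : Eu m => ‖y‖ ^ 2) (2 • innerSL ℝ x) x :=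
    (hasStrictFDerivAt_norm_sq x).hasFDerivAt
  have h2 := hk.comp_hasFDerivAt x h1
  have h3 : fderiv ℝ (fun y : Eu m => k (‖y‖ ^ 2)) x = k' • (2 • innerSL ℝ x) := h2.fderiv
  simp [pd, h3, stdVec, EuclideanSpace.inner_single_right]
  ring

/-- The profile is a function of `s = |x|²`, which avoids the singularity of `|x|` at the origin.
For `k = e^{-s/4}` the four terms cancel: the Gaussian lies in the kernel of the adjoint. -/
lemma driftAdjoint_radial {k k' k'' : ℝ → ℝ} (hk : ∀ s, HasDerivAt k (k' s) s)
    (hk' : ∀ s, HasDerivAt k' (k'' s) s) (x : Eu m) :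
    driftAdjoint (fun y : Eu m => k (‖y‖ ^ 2)) x
      = 2 * m * k' (‖x‖ ^ 2) + 4 * ‖x‖ ^ 2 * k'' (‖x‖ ^ 2) + m / 2 * k (‖x‖ ^ 2)
        + ‖x‖ ^ 2 * k' (‖x‖ ^ 2) := by
  have hd : ∀ {w w' : ℝ → ℝ}, (∀ s, HasDerivAt w (w' s) s) →
      DifferentiableAt ℝ (fun y : Eu m => w (‖y‖ ^ 2)) x := fun hw =>
    ((hw _).differentiableAt).comp x ((differentiable_id.norm_sq ℝ) x)
  have h1 : ∀ α, pd α (fun y : Eu m => k (‖y‖ ^ 2)) = fun y => 2 * y α * k' (‖y‖ ^ 2) :=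
    fun α => funext fun y => pd_radial (hk _) α
  have hc : ∀ α, DifferentiableAt ℝ (fun y : Eu m => 2 * y α) x := fun α =>
    (differentiableAt_coord α x).const_mul 2
  have hc' : ∀ α, DifferentiableAt ℝ (fun y : Eu m => y α / 2) x := fun α => by
    simp only [div_eq_mul_inv]
    exact (differentiableAt_coord α x).mul_const _
  have p1 : ∀ α : Fin m, pd α (fun y : Eu m => 2 * y α) x = 2 := fun α => by
    rw [pd_mul (differentiableAt_const _) (differentiableAt_coord α x), pd_const, pd_coord]; simp
  have p2 : ∀ α : Fin m, pd α (fun y : Eu m => y α / 2) x = 1 / 2 := fun α => by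
    simp only [div_eq_mul_inv]
    rw [pd_mul (differentiableAt_coord α x) (differentiableAt_const _), pd_const, pd_coord]; simp
  have hx : ‖x‖ ^ 2 = ∑ α, x α ^ 2 := by
    rw [EuclideanSpace.norm_sq_eq]; simp
  have h2 : ∀ α, pd α (pd α (fun y : Eu m => k (‖y‖ ^ 2))) x
      + pd α (fun y => k (‖y‖ ^ 2) * (y α / 2)) x
      = (2 * k' (‖x‖ ^ 2) + 1 / 2 * k (‖x‖ ^ 2))
        + x α ^ 2 * (4 * k'' (‖x‖ ^ 2) + k' (‖x‖ ^ 2)) := by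
    intro α
    rw [h1, pd_mul (hc α) (hd hk'), pd_mul (hd hk) (hc' α), p1, p2, pd_radial (hk _),
      pd_radial (hk' _)]
    ring
  rw [driftAdjoint, Finset.sum_congr rfl fun α _ => h2 α, Finset.sum_add_distrib,
    ← Finset.sum_mul, ← hx]
  simp
  ring

/-- A smooth function equal to `1` on `(-∞, 1]` and vanishing on `[2, ∞)`. -/
def stepDown (t : ℝ) : ℝ := Real.smoothTransition (2 - t)

lemma contDiff_stepDown : ContDiff ℝ ∞ stepDown :=
  Real.smoothTransition.contDiff.comp (contDiff_const.sub contDiff_id)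

lemma stepDown_of_le {t : ℝ} (ht : t ≤ 1) : stepDown t = 1 :=
  Real.smoothTransition.one_of_one_le (by linarith)

lemma stepDown_of_ge {t : ℝ} (ht : 2 ≤ t) : stepDown t = 0 :=
  Real.smoothTransition.zero_of_nonpos (by linarith)

lemma deriv_stepDown_eq_zero {t : ℝ} (ht : t < 1 ∨ 2 < t) : deriv stepDown t = 0 := by
  rcases ht with ht | ht
  · have : stepDown =ᶠ[𝓝 t] fun _ => 1 :=
      (eventually_lt_nhds ht).mono fun s hs => stepDown_of_le hs.le
    simp [this.deriv_eq]
  · have : stepDown =ᶠ[𝓝 t] fun _ => 0 :=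
      (eventually_gt_nhds ht).mono fun s hs => stepDown_of_ge hs.le
    simp [this.deriv_eq]

lemma deriv_deriv_stepDown_eq_zero {t : ℝ} (ht : t < 1 ∨ 2 < t) :
    deriv (deriv stepDown) t = 0 := by
  have : deriv stepDown =ᶠ[𝓝 t] fun _ => 0 := by
    rcases ht with ht | ht
    · exact (eventually_lt_nhds ht).mono fun s hs => deriv_stepDown_eq_zero (Or.inl hs)
    · exact (eventually_gt_nhds ht).mono fun s hs => deriv_stepDown_eq_zero (Or.inr hs)
  simp [this.deriv_eq]

lemma contDiff_deriv_stepDown : ContDiff ℝ ∞ (deriv stepDown) :=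
  (contDiff_infty_iff_deriv.1 contDiff_stepDown).2

lemma contDiff_deriv_deriv_stepDown : ContDiff ℝ ∞ (deriv (deriv stepDown)) :=
  (contDiff_infty_iff_deriv.1 contDiff_deriv_stepDown).2

lemma hasDerivAt_stepDown (t : ℝ) : HasDerivAt stepDown (deriv stepDown t) t :=
  (contDiff_stepDown.differentiable (by simp) t).hasDerivAt

lemma hasDerivAt_deriv_stepDown (t : ℝ) :
    HasDerivAt (deriv stepDown) (deriv (deriv stepDown) t) t :=
  (contDiff_deriv_stepDown.differentiable (by simp) t).hasDerivAt

lemma exists_bound_deriv_stepDown :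
    ∃ M, 0 ≤ M ∧ ∀ t, |deriv stepDown t| ≤ M ∧ |deriv (deriv stepDown) t| ≤ M := by
  obtain ⟨A, hA⟩ := isCompact_Icc.exists_bound_of_continuousOn
    (s := Set.Icc (1 : ℝ) 2) contDiff_deriv_stepDown.continuous.continuousOn
  obtain ⟨B, hB⟩ := isCompact_Icc.exists_bound_of_continuousOn
    (s := Set.Icc (1 : ℝ) 2) contDiff_deriv_deriv_stepDown.continuous.continuousOn
  refine ⟨max 0 (max A B), le_max_left _ _, fun t => ?_⟩
  by_cases ht : t ∈ Set.Icc (1 : ℝ) 2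
  · exact ⟨(hA t ht).trans ((le_max_left _ _).trans (le_max_right _ _)),
      (hB t ht).trans ((le_max_right _ _).trans (le_max_right _ _))⟩
  · have : t < 1 ∨ 2 < t := by
      by_contra! hh
      exact ht hh
    rw [deriv_stepDown_eq_zero this, deriv_deriv_stepDown_eq_zero this]
    simp

/-- The radial profile of the truncated Gaussian weight. -/
def profile (T s : ℝ) : ℝ := stepDown (s / T) * Real.exp (-s / 4)

/-- The truncated Gaussian weight `e^{-|x|² / 4}`, vanishing where `|x|² ≥ 2 T`. -/
def weight (T : ℝ) (x : Eu m) : ℝ := profile T (‖x‖ ^ 2)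

lemma contDiff_weight (T : ℝ) : ContDiff ℝ ∞ (weight T : Eu m → ℝ) := by
  have h : ContDiff ℝ ∞ (fun x : Eu m => ‖x‖ ^ 2) := contDiff_norm_sq ℝ
  exact (contDiff_stepDown.comp (h.div_const T)).mul (Real.contDiff_exp.comp (h.neg.div_const 4))

lemma weight_nonneg (T : ℝ) (x : Eu m) : 0 ≤ weight T x :=
  mul_nonneg (Real.smoothTransition.nonneg _) (Real.exp_pos _).le

lemma weight_eq_zero {T : ℝ} (hT : 0 < T) {x : Eu m} (hx : 2 * T ≤ ‖x‖ ^ 2) : weight T x = 0 := by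
  rw [weight, profile, stepDown_of_ge (by rwa [le_div_iff₀ hT]), zero_mul]

lemma weight_eq_exp {T : ℝ} (hT : 0 < T) {x : Eu m} (hx : ‖x‖ ^ 2 ≤ T) :
    weight T x = Real.exp (-‖x‖ ^ 2 / 4) := by
  rw [weight, profile, stepDown_of_le (by rwa [div_le_one hT]), one_mul]

lemma hasCompactSupport_weight {T : ℝ} (hT : 0 < T) :
    HasCompactSupport (weight T : Eu m → ℝ) := by
  refine HasCompactSupport.of_support_subset_isCompact
    (isCompact_closedBall (0 : Eu m) (2 * T + 1)) fun x hx => ?_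
  rw [mem_closedBall_zero_iff]
  by_contra! h
  refine hx (weight_eq_zero hT ?_)
  nlinarith

/-- Since the adjoint kills the pure Gaussian, every surviving term contains a derivative of the
cutoff. -/
lemma driftAdjoint_weight {T : ℝ} (hT : 0 < T) (x : Eu m) :
    driftAdjoint (weight T) x = Real.exp (-‖x‖ ^ 2 / 4) *
      (4 * (‖x‖ ^ 2 / T) * deriv (deriv stepDown) (‖x‖ ^ 2 / T) / T
        - (‖x‖ ^ 2 / T) * deriv stepDown (‖x‖ ^ 2 / T)
        + 2 * m * deriv stepDown (‖x‖ ^ 2 / T) / T) := by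
  have he : ∀ s : ℝ, HasDerivAt (fun s : ℝ => Real.exp (-s / 4)) (Real.exp (-s / 4) * (-1 / 4)) s :=
    fun s => ((hasDerivAt_neg s).div_const 4).exp
  have hdiv : ∀ s : ℝ, HasDerivAt (fun s : ℝ => s / T) (1 / T) s :=
    fun s => (hasDerivAt_id s).div_const T
  have h0 : ∀ s : ℝ, HasDerivAt (fun s : ℝ => stepDown (s / T))
      (deriv stepDown (s / T) * (1 / T)) s :=
    fun s => HasDerivAt.comp (h₂ := stepDown) s (hasDerivAt_stepDown (s / T)) (hdiv s)
  have h1 : ∀ s : ℝ, HasDerivAt (fun s : ℝ => deriv stepDown (s / T))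
      (deriv (deriv stepDown) (s / T) * (1 / T)) s :=
    fun s => HasDerivAt.comp (h₂ := deriv stepDown) s (hasDerivAt_deriv_stepDown (s / T)) (hdiv s)
  have hk : ∀ s, HasDerivAt (profile T)
      (deriv stepDown (s / T) * (1 / T) * Real.exp (-s / 4)
        + stepDown (s / T) * (Real.exp (-s / 4) * (-1 / 4))) s :=
    fun s => (h0 s).mul (he s)
  have hk' := fun s => (((h1 s).mul_const (1 / T)).mul (he s)).add
    ((h0 s).mul ((he s).mul_const (-1 / 4)))
  have := driftAdjoint_radial (m := m) hk hk' x
  refine this.trans ?_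
  rw [profile]
  field_simp
  ring

/-- The derivatives of the cutoff live on `T ≤ |x|² ≤ 2T`, where the Gaussian is at most `e^{-T/4}`.
This exponential factor will beat any polynomial growth. -/
lemma exists_bound_driftAdjoint_weight (m : ℕ) :
    ∃ C, 0 ≤ C ∧ ∀ T, 1 ≤ T → ∀ x : Eu m,
      driftAdjoint (weight T) x ≤ C * Real.exp (-T / 4) ∧
      (2 * T < ‖x‖ ^ 2 → driftAdjoint (weight T) x = 0) := by
  obtain ⟨M, hM, hb⟩ := exists_bound_deriv_stepDown
  -- One summand for each term of `driftAdjoint_weight`, estimated with `t ≤ 2` and `1 / T ≤ 1`.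
  refine ⟨8 * M + 2 * M + 2 * m * M, by positivity, fun T hT x => ?_⟩
  have hT0 : 0 < T := by linarith
  rw [driftAdjoint_weight hT0]
  set t := ‖x‖ ^ 2 / T with ht
  have hzero : t < 1 ∨ 2 < t → Real.exp (-‖x‖ ^ 2 / 4) *
      (4 * t * deriv (deriv stepDown) t / T - t * deriv stepDown t
        + 2 * m * deriv stepDown t / T) = 0 := fun h => by
    rw [deriv_stepDown_eq_zero h, deriv_deriv_stepDown_eq_zero h]; simp
  refine ⟨?_, fun h => hzero (Or.inr (by rwa [ht, lt_div_iff₀ hT0]))⟩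
  by_cases h : t < 1 ∨ 2 < t
  · rw [hzero h]; positivity
  · push Not at h
    have h1 : Real.exp (-‖x‖ ^ 2 / 4) ≤ Real.exp (-T / 4) := by
      have : T ≤ ‖x‖ ^ 2 := by rw [ht, le_div_iff₀ hT0] at h; linarith [h.1]
      apply Real.exp_le_exp.2
      linarith
    obtain ⟨b1, b2⟩ := hb t
    have b1' := abs_le.1 b1
    have b2' := abs_le.1 b2
    have hdivT : ∀ a b : ℝ, 0 ≤ b → a ≤ b → a / T ≤ b := fun a b hb hab =>
      (div_le_div_of_nonneg_right hab hT0.le).trans (div_le_self hb hT)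
    have c1 : 4 * t * deriv (deriv stepDown) t / T ≤ 8 * M := by
      refine hdivT _ _ (by positivity) ?_
      nlinarith
    have c2 : 2 * m * deriv stepDown t / T ≤ 2 * m * M := by
      refine hdivT _ _ (by positivity) ?_
      have : (0 : ℝ) ≤ m := by positivity
      nlinarith
    have c3 : - (t * deriv stepDown t) ≤ 2 * M := by nlinarith
    have c4 : 4 * t * deriv (deriv stepDown) t / T - t * deriv stepDown t
        + 2 * m * deriv stepDown t / T ≤ 8 * M + 2 * M + 2 * m * M := by linarith
    calc _ ≤ Real.exp (-‖x‖ ^ 2 / 4) * (8 * M + 2 * M + 2 * m * M) :=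
          mul_le_mul_of_nonneg_left c4 (Real.exp_pos _).le
      _ ≤ Real.exp (-T / 4) * (8 * M + 2 * M + 2 * m * M) :=
          mul_le_mul_of_nonneg_right h1 (by positivity)
      _ = _ := mul_comm _ _

/-! ### The Liouville argument. -/

lemma tendsto_polynomial_mul_exp_neg (p : Polynomial ℝ) :
    Tendsto (fun r : ℝ => p.eval r * Real.exp (-r)) atTop (𝓝 0) := by
  simpa [Real.exp_neg, div_eq_mul_inv] using p.tendsto_div_exp_atTop

lemma continuous_driftLaplacian {φ : Eu m → ℝ} (hφ : ContDiff ℝ ∞ φ) :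
    Continuous (driftLaplacian φ) := by
  refine continuous_finsetSum _ fun α _ => ?_
  exact (contDiff_pd_infty (contDiff_pd_infty hφ α) α).continuous.sub
    ((((contDiff_coord (r := 0) α).continuous).div_const 2).mul
      (contDiff_pd_infty hφ α).continuous)

/-- A nonnegative function whose integrals over balls grow at most polynomially and which is
subharmonic for the drift Laplacian is harmonic for it. -/
theorem driftLaplacian_eq_zero {φ e : Eu m → ℝ} (hφ : ContDiff ℝ ∞ φ) (he : Continuous e)
    (h0 : ∀ x, 0 ≤ φ x) (he0 : ∀ x, 0 ≤ e x) (hφe : ∀ x, φ x ≤ ‖x‖ ^ 2 / 4 * e x)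
    (p : Polynomial ℝ) (hp : ∀ r, 0 ≤ r → ∫ x in Metric.ball 0 r, e x ≤ p.eval r)
    (hL : ∀ x, 0 ≤ driftLaplacian φ x) (x : Eu m) : driftLaplacian φ x = 0 := by
  obtain ⟨C, hC, hb⟩ := exists_bound_driftAdjoint_weight m
  have hLc := continuous_driftLaplacian hφ
  -- The cutoff parameter `T = 4r` makes `e^{-T/4}` equal to `e^{-r}`. The adjoint vanishes where
  -- `|x|² > 8r`, in particular outside the ball of radius `2r` since `r ≥ 4`; on that ball `|x|²/4
  -- ≤ r²`.
  have key : ∀ r : ℝ, 4 ≤ r → ∫ x : Eu m, weight (4 * r) x * driftLaplacian φ x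
      ≤ C * (r ^ 2 * p.eval (2 * r)) * Real.exp (-r) := by
    intro r hr
    have hr0 : 0 < 4 * r := by linarith
    have hout : ∀ y : Eu m, y ∉ Metric.ball (0 : Eu m) (2 * r) →
        driftAdjoint (weight (4 * r)) y * φ y = 0 := by
      intro y hy
      rw [mem_ball_zero_iff, not_lt] at hy
      rw [(hb (4 * r) (by linarith) y).2 (by nlinarith), zero_mul]
    have hsupp : HasCompactSupport fun y : Eu m => driftAdjoint (weight (4 * r)) y * φ y := by
      refine HasCompactSupport.of_support_subset_isCompact
        (isCompact_closedBall (0 : Eu m) (2 * r)) fun y hy => ?_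
      by_contra hn
      exact hy (hout y fun h => hn (Metric.ball_subset_closedBall h))
    have hadj : Continuous (driftAdjoint (weight (4 * r) : Eu m → ℝ)) := by
      have hw := contDiff_weight (m := m) (4 * r)
      refine continuous_finsetSum _ fun α _ => ?_
      exact (contDiff_pd_infty (contDiff_pd_infty hw α) α).continuous.add
        (contDiff_pd_infty (hw.mul ((contDiff_coord α).div_const 2)) α).continuous
    have hei : IntegrableOn e (Metric.ball (0 : Eu m) (2 * r)) :=
      (he.continuousOn.integrableOn_compact (isCompact_closedBall _ _)).mono_set
        Metric.ball_subset_closedBall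
    rw [integral_mul_driftLaplacian (contDiff_weight _) hφ (hasCompactSupport_weight hr0),
      ← setIntegral_eq_integral_of_forall_compl_eq_zero hout]
    have hstep : ∫ y in Metric.ball (0 : Eu m) (2 * r), driftAdjoint (weight (4 * r)) y * φ y
        ≤ ∫ y in Metric.ball (0 : Eu m) (2 * r), C * r ^ 2 * Real.exp (-r) * e y := by
      refine setIntegral_mono_on
        ((hadj.mul hφ.continuous).integrable_of_hasCompactSupport hsupp).integrableOn
        (hei.const_mul _) measurableSet_ball fun y hy => ?_
      rw [mem_ball_zero_iff] at hy
      have h1 := (hb (4 * r) (by linarith) y).1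
      rw [show -(4 * r) / 4 = -r by ring] at h1
      have h2 : φ y ≤ r ^ 2 * e y := (hφe y).trans
        (mul_le_mul_of_nonneg_right (by nlinarith [norm_nonneg y]) (he0 y))
      calc _ ≤ C * Real.exp (-r) * φ y := mul_le_mul_of_nonneg_right h1 (h0 y)
        _ ≤ C * Real.exp (-r) * (r ^ 2 * e y) := mul_le_mul_of_nonneg_left h2 (by positivity)
        _ = _ := by ring
    refine hstep.trans ?_
    rw [integral_const_mul]
    calc _ ≤ C * r ^ 2 * Real.exp (-r) * p.eval (2 * r) :=
          mul_le_mul_of_nonneg_left (hp _ (by linarith)) (by positivity)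
      _ = _ := by ring
  have hlim : Tendsto (fun r : ℝ => C * (r ^ 2 * p.eval (2 * r)) * Real.exp (-r)) atTop (𝓝 0) := by
    have := tendsto_polynomial_mul_exp_neg
      (Polynomial.C C * (Polynomial.X ^ 2 * p.comp (Polynomial.C 2 * Polynomial.X)))
    simpa using this
  by_contra hne
  -- With this fixed `T` the weight is positive at `x`, so the weighted integral of `Lφ` is
  -- positive. The weights increase with the cutoff parameter and `Lφ ≥ 0`, so the integrals in
  -- `key` stay above this number once `r ≥ T`, although their bounds tend to `0`.
  set T := ‖x‖ ^ 2 + 1 with hTdef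
  have hT : 0 < T := by positivity
  have hpos : 0 < ∫ y : Eu m, weight T y * driftLaplacian φ y := by
    refine ((contDiff_weight T).continuous.mul hLc).integral_pos_of_hasCompactSupport_nonneg_nonzero
      (hasCompactSupport_weight hT).mul_right
      (fun y => mul_nonneg (weight_nonneg _ _) (hL y)) (x := x) ?_
    rw [weight_eq_exp hT (by linarith)]
    exact mul_ne_zero (Real.exp_pos _).ne' hne
  refine absurd (ge_of_tendsto hlim ?_) (not_le.2 hpos)
  filter_upwards [eventually_ge_atTop (4 : ℝ), eventually_ge_atTop T] with r hr hrT
  refine le_trans ?_ (key r hr)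
  have hint : ∀ S : ℝ, 0 < S → Integrable fun y : Eu m => weight S y * driftLaplacian φ y :=
    fun S hS => ((contDiff_weight S).continuous.mul hLc).integrable_of_hasCompactSupport
      (hasCompactSupport_weight hS).mul_right
  refine integral_mono (hint T hT) (hint (4 * r) (by linarith)) fun y => ?_
  refine mul_le_mul_of_nonneg_right (mul_le_mul_of_nonneg_right ?_ (Real.exp_pos _).le) (hL y)
  refine Real.smoothTransition.monotone (sub_le_sub_left ?_ 2)
  exact div_le_div_of_nonneg_left (by positivity) hT (by linarith)

end Liouville

/-! ### Covariant differentiation along a map into a coordinate chart -/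

section AlongMap

variable {m n : ℕ}

/-- The connection matrix `A_α = Γ(∂_α F)` along `F`. -/
def connMatrix (Γ : Fin n → Fin n → Fin n → Eu n → ℝ) (F : Eu m → Eu n) (α : Fin m) (k j : Fin n)
    (x : Eu m) : ℝ :=
  ∑ i, Γ k i j (F x) * pd α (fun y => F y i) x

/-- The components of the covariant derivative `∇_α W` of a vector field along `F`. -/
def covDeriv (Γ : Fin n → Fin n → Fin n → Eu n → ℝ) (F : Eu m → Eu n) (α : Fin m)
    (W : Fin n → Eu m → ℝ) (k : Fin n) (x : Eu m) : ℝ :=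
  pd α (W k) x + ∑ j, connMatrix Γ F α k j x * W j x

/-- The inner product of two vector fields along `F`. -/
def innerAlong (G : Fin n → Fin n → Eu n → ℝ) (F : Eu m → Eu n) (W Z : Fin n → Eu m → ℝ)
    (x : Eu m) : ℝ :=
  ∑ i, ∑ j, G i j (F x) * W i x * Z j x

/-- The curvature components of the connection with coefficients `Γ`. -/
def curvComp (Γ : Fin n → Fin n → Fin n → Eu n → ℝ) (l i j k : Fin n) (y : Eu n) : ℝ :=
  pd i (Γ l j k) y - pd j (Γ l i k) y + ∑ p, (Γ p j k y * Γ l i p y - Γ p i k y * Γ l j p y)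

/-- The components of `R(X, Y) W` for vector fields along `F`. -/
def curvAlong (Γ : Fin n → Fin n → Fin n → Eu n → ℝ) (F : Eu m → Eu n)
    (X Y W : Fin n → Eu m → ℝ) (l : Fin n) (x : Eu m) : ℝ :=
  ∑ i, ∑ j, ∑ k, curvComp Γ l i j k (F x) * X i x * Y j x * W k x

/-- The components of the coordinate vector field `∂_α F`. -/
def partialAlong (F : Eu m → Eu n) (α : Fin m) (k : Fin n) (x : Eu m) : ℝ :=
  pd α (fun y => F y k) x

/-- The components of `dF(x / 2)`. -/
def radialAlong (F : Eu m → Eu n) (k : Fin n) (x : Eu m) : ℝ :=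
  ∑ γ, x γ / 2 * partialAlong F γ k x

/-- `F` is a smooth map from `U` into `Ω`, and `Γ` is a smooth torsion-free connection on `Ω`
compatible with the smooth symmetric form `G`. -/
structure IsChartMap (G : Fin n → Fin n → Eu n → ℝ) (Γ : Fin n → Fin n → Fin n → Eu n → ℝ)
    (F : Eu m → Eu n) (U : Set (Eu m)) (Ω : Set (Eu n)) : Prop where
  isOpen_source : IsOpen U
  isOpen_target : IsOpen Ω
  mapsTo : Set.MapsTo F U Ω
  contDiffOn : ContDiffOn ℝ ∞ F U
  contDiffOn_metric : ∀ i j, ContDiffOn ℝ ∞ (G i j) Ω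
  contDiffOn_christoffel : ∀ k i j, ContDiffOn ℝ ∞ (Γ k i j) Ω
  metric_symm : ∀ i j, ∀ y ∈ Ω, G i j y = G j i y
  christoffel_symm : ∀ k i j, ∀ y ∈ Ω, Γ k i j y = Γ k j i y
  compatible : ∀ l i j, ∀ y ∈ Ω,
    pd l (G i j) y = ∑ p, (Γ p l i y * G p j y + Γ p l j y * G i p y)

namespace IsChartMap

variable {G : Fin n → Fin n → Eu n → ℝ} {Γ : Fin n → Fin n → Fin n → Eu n → ℝ}
  {F : Eu m → Eu n} {U : Set (Eu m)} {Ω : Set (Eu n)}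

section

variable (P : IsChartMap G Γ F U Ω)
include P

lemma differentiableAt {u : Eu m → ℝ} (hu : ContDiffOn ℝ ∞ u U) {x : Eu m} (hx : x ∈ U) :
    DifferentiableAt ℝ u x :=
  (hu.contDiffAt (P.isOpen_source.mem_nhds hx)).differentiableAt (by simp)

lemma differentiableAt_map {x : Eu m} (hx : x ∈ U) : DifferentiableAt ℝ F x :=
  (P.contDiffOn.contDiffAt (P.isOpen_source.mem_nhds hx)).differentiableAt (by simp)

lemma differentiableAt_target {u : Eu n → ℝ} (hu : ContDiffOn ℝ ∞ u Ω) {x : Eu m} (hx : x ∈ U) :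
    DifferentiableAt ℝ u (F x) :=
  (hu.contDiffAt (P.isOpen_target.mem_nhds (P.mapsTo hx))).differentiableAt (by simp)

lemma pd_congr_on {u v : Eu m → ℝ} (h : ∀ y ∈ U, u y = v y) {x : Eu m} (hx : x ∈ U)
    (α : Fin m) : pd α u x = pd α v x :=
  pd_congr (Filter.eventuallyEq_of_mem (P.isOpen_source.mem_nhds hx) h)

lemma contDiffOn_component (k : Fin n) : ContDiffOn ℝ ∞ (fun y => F y k) U :=
  (contDiff_coord k).comp_contDiffOn P.contDiffOn

lemma contDiffOn_partialAlong (α : Fin m) (k : Fin n) : ContDiffOn ℝ ∞ (partialAlong F α k) U :=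
  contDiffOn_pd P.isOpen_source (P.contDiffOn_component k) α

lemma contDiffOn_comp {u : Eu n → ℝ} (hu : ContDiffOn ℝ ∞ u Ω) :
    ContDiffOn ℝ ∞ (fun x => u (F x)) U :=
  hu.comp P.contDiffOn P.mapsTo

lemma contDiffOn_connMatrix (α : Fin m) (k j : Fin n) :
    ContDiffOn ℝ ∞ (connMatrix Γ F α k j) U :=
  ContDiffOn.sum fun i _ => (P.contDiffOn_comp (P.contDiffOn_christoffel k i j)).mul
    (P.contDiffOn_partialAlong α i)

lemma contDiffOn_covDeriv {W : Fin n → Eu m → ℝ} (hW : ∀ k, ContDiffOn ℝ ∞ (W k) U) (α : Fin m)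
    (k : Fin n) : ContDiffOn ℝ ∞ (covDeriv Γ F α W k) U :=
  (contDiffOn_pd P.isOpen_source (hW k) α).add
    (ContDiffOn.sum fun j _ => (P.contDiffOn_connMatrix α k j).mul (hW j))

lemma contDiffOn_innerAlong {W Z : Fin n → Eu m → ℝ} (hW : ∀ k, ContDiffOn ℝ ∞ (W k) U)
    (hZ : ∀ k, ContDiffOn ℝ ∞ (Z k) U) : ContDiffOn ℝ ∞ (innerAlong G F W Z) U :=
  ContDiffOn.sum fun i _ => ContDiffOn.sum fun j _ =>
    ((P.contDiffOn_comp (P.contDiffOn_metric i j)).mul (hW i)).mul (hZ j)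

lemma contDiffOn_radialAlong (k : Fin n) : ContDiffOn ℝ ∞ (radialAlong F k) U :=
  ContDiffOn.sum fun γ _ => ((contDiff_coord γ).div_const 2).contDiffOn.mul
    (P.contDiffOn_partialAlong γ k)

lemma covDeriv_congr {W Z : Fin n → Eu m → ℝ} (h : ∀ k, ∀ y ∈ U, W k y = Z k y) {x : Eu m}
    (hx : x ∈ U) (α : Fin m) (k : Fin n) : covDeriv Γ F α W k x = covDeriv Γ F α Z k x := by
  simp only [covDeriv, P.pd_congr_on (h k) hx, h _ x hx]

/-- A single Leibniz rule, specialised below to sums, to constant multiples, and to the coefficients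
`y γ / 2` of the radial field. -/
lemma covDeriv_sum_mul {ι : Type*} [Fintype ι] {g : ι → Eu m → ℝ} {W : ι → Fin n → Eu m → ℝ}
    (hg : ∀ γ, ContDiffOn ℝ ∞ (g γ) U) (hW : ∀ γ k, ContDiffOn ℝ ∞ (W γ k) U) {x : Eu m}
    (hx : x ∈ U) (α : Fin m) (k : Fin n) :
    covDeriv Γ F α (fun k y => ∑ γ, g γ y * W γ k y) k x
      = ∑ γ, (pd α (g γ) x * W γ k x + g γ x * covDeriv Γ F α (W γ) k x) := by
  have h1 : pd α (fun y => ∑ γ, g γ y * W γ k y) x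
      = ∑ γ, (pd α (g γ) x * W γ k x + g γ x * pd α (W γ k) x) := by
    rw [pd_sum fun γ _ => (P.differentiableAt (hg γ) hx).fun_mul (P.differentiableAt (hW γ k) hx)]
    exact Finset.sum_congr rfl fun γ _ =>
      pd_mul (P.differentiableAt (hg γ) hx) (P.differentiableAt (hW γ k) hx)
  have h2 : ∑ j, connMatrix Γ F α k j x * ∑ γ, g γ x * W γ j x
      = ∑ γ, g γ x * ∑ j, connMatrix Γ F α k j x * W γ j x := by
    simp only [Finset.mul_sum]
    rw [Finset.sum_comm]
    exact Finset.sum_congr rfl fun γ _ => Finset.sum_congr rfl fun j _ => by ring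
  rw [covDeriv, h1, h2, ← Finset.sum_add_distrib]
  exact Finset.sum_congr rfl fun γ _ => by rw [covDeriv]; ring

lemma covDeriv_sum {ι : Type*} [Fintype ι] {W : ι → Fin n → Eu m → ℝ}
    (hW : ∀ γ k, ContDiffOn ℝ ∞ (W γ k) U) {x : Eu m} (hx : x ∈ U) (α : Fin m) (k : Fin n) :
    covDeriv Γ F α (fun k y => ∑ γ, W γ k y) k x = ∑ γ, covDeriv Γ F α (W γ) k x := by
  have := P.covDeriv_sum_mul (g := fun _ _ => 1) (fun _ => contDiffOn_const) hW hx α k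
  simpa [pd_const] using this

/-- The connection is torsion-free. -/
lemma covDeriv_partialAlong_comm {x : Eu m} (hx : x ∈ U) (α β : Fin m) (k : Fin n) :
    covDeriv Γ F α (partialAlong F β) k x = covDeriv Γ F β (partialAlong F α) k x := by
  have h1 : pd α (partialAlong F β k) x = pd β (partialAlong F α k) x :=
    pd_comm P.isOpen_source hx (P.contDiffOn_component k) α β
  rw [covDeriv, covDeriv, h1]
  congr 1
  simp only [connMatrix, Finset.sum_mul]
  rw [Finset.sum_comm]
  refine Finset.sum_congr rfl fun i _ => Finset.sum_congr rfl fun j _ => ?_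
  rw [P.christoffel_symm k i j _ (P.mapsTo hx)]
  simp only [partialAlong]
  ring

/-! ### Curvature of the pulled-back connection. -/

lemma pd_connMatrix {x : Eu m} (hx : x ∈ U) (α β : Fin m) (k j : Fin n) :
    pd α (connMatrix Γ F β k j) x
      = ∑ l, ∑ i, pd l (Γ k i j) (F x) * partialAlong F α l x * partialAlong F β i x
        + ∑ i, Γ k i j (F x) * pd α (partialAlong F β i) x := by
  have hΓ : ∀ i, DifferentiableAt ℝ (fun y => Γ k i j (F y)) x := fun i =>
    P.differentiableAt (P.contDiffOn_comp (P.contDiffOn_christoffel k i j)) hx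
  have hF : ∀ i, DifferentiableAt ℝ (partialAlong F β i) x := fun i =>
    P.differentiableAt (P.contDiffOn_partialAlong β i) hx
  have h0 : connMatrix Γ F β k j = fun y => ∑ i, Γ k i j (F y) * partialAlong F β i y := rfl
  rw [h0, pd_sum fun i _ => (hΓ i).fun_mul (hF i), Finset.sum_comm, ← Finset.sum_add_distrib]
  refine Finset.sum_congr rfl fun i _ => ?_
  rw [pd_mul (hΓ i) (hF i), pd_comp (P.differentiableAt_target (P.contDiffOn_christoffel k i j) hx)
    (P.differentiableAt_map hx), Finset.sum_mul]
  rfl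

/-- The structure equation `dA + A ∧ A = F*R`: the terms with second derivatives of `F` cancel
because mixed partials commute. -/
lemma connMatrix_curvature {x : Eu m} (hx : x ∈ U) (α β : Fin m) (k j : Fin n) :
    pd α (connMatrix Γ F β k j) x - pd β (connMatrix Γ F α k j) x
        + ∑ q, (connMatrix Γ F α k q x * connMatrix Γ F β q j x
          - connMatrix Γ F β k q x * connMatrix Γ F α q j x)
      = ∑ l, ∑ i, curvComp Γ k l i j (F x) * partialAlong F α l x * partialAlong F β i x := by
  have h1 : ∀ i, pd α (partialAlong F β i) x = pd β (partialAlong F α i) x := fun i =>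
    pd_comm P.isOpen_source hx (P.contDiffOn_component i) α β
  have h2 : ∀ (a b : Fin m), ∑ q, connMatrix Γ F a k q x * connMatrix Γ F b q j x
      = ∑ l, ∑ i, ∑ q, Γ k l q (F x) * Γ q i j (F x) * partialAlong F a l x
        * partialAlong F b i x := by
    intro a b
    simp only [connMatrix, Finset.sum_mul_sum]
    rw [Finset.sum_comm]
    refine Finset.sum_congr rfl fun l _ => ?_
    rw [Finset.sum_comm]
    refine Finset.sum_congr rfl fun i _ => Finset.sum_congr rfl fun q _ => ?_
    simp only [partialAlong]
    ring
  rw [P.pd_connMatrix hx, P.pd_connMatrix hx, Finset.sum_sub_distrib, h2 α β, h2 β α,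
    Finset.sum_comm (f := fun l i => pd l (Γ k i j) (F x) * partialAlong F β l x
      * partialAlong F α i x),
    Finset.sum_comm (f := fun l i => ∑ q, Γ k l q (F x) * Γ q i j (F x) * partialAlong F β l x
      * partialAlong F α i x)]
  simp only [h1]
  rw [add_sub_add_right_eq_sub, ← Finset.sum_sub_distrib, ← Finset.sum_sub_distrib,
    ← Finset.sum_add_distrib]
  refine Finset.sum_congr rfl fun l _ => ?_
  rw [← Finset.sum_sub_distrib, ← Finset.sum_sub_distrib, ← Finset.sum_add_distrib]
  refine Finset.sum_congr rfl fun i _ => ?_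
  rw [curvComp, add_mul, add_mul, Finset.sum_mul, Finset.sum_mul, ← Finset.sum_sub_distrib]
  congr 1
  · ring
  · exact Finset.sum_congr rfl fun q _ => by ring

/-- Arranged so that everything differentiating `W` is symmetric in `α` and `β`; the commutator then
contains only the zeroth-order part. -/
lemma covDeriv_covDeriv {W : Fin n → Eu m → ℝ} (hW : ∀ k, ContDiffOn ℝ ∞ (W k) U) {x : Eu m}
    (hx : x ∈ U) (α β : Fin m) (k : Fin n) :
    covDeriv Γ F α (covDeriv Γ F β W) k x
      = pd α (pd β (W k)) x
        + ∑ j, (connMatrix Γ F β k j x * pd α (W j) x + connMatrix Γ F α k j x * pd β (W j) x)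
        + ∑ j, (pd α (connMatrix Γ F β k j) x
          + ∑ q, connMatrix Γ F α k q x * connMatrix Γ F β q j x) * W j x := by
  have hA : ∀ j, DifferentiableAt ℝ (connMatrix Γ F β k j) x := fun j =>
    P.differentiableAt (P.contDiffOn_connMatrix β k j) hx
  have hWd : ∀ j, DifferentiableAt ℝ (W j) x := fun j => P.differentiableAt (hW j) hx
  have h1 : pd α (covDeriv Γ F β W k) x = pd α (pd β (W k)) x
      + ∑ j, (pd α (connMatrix Γ F β k j) x * W j x + connMatrix Γ F β k j x * pd α (W j) x) := by
    have h0 : covDeriv Γ F β W k = fun y => pd β (W k) y + ∑ j, connMatrix Γ F β k j y * W j y :=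
      rfl
    rw [h0, pd_add (P.differentiableAt (contDiffOn_pd P.isOpen_source (hW k) β) hx)
      (DifferentiableAt.fun_sum fun j _ => (hA j).fun_mul (hWd j)),
      pd_sum fun j _ => (hA j).fun_mul (hWd j)]
    simp only [pd_mul (hA _) (hWd _)]
  have h2 : ∑ q, connMatrix Γ F α k q x * covDeriv Γ F β W q x
      = ∑ j, connMatrix Γ F α k j x * pd β (W j) x
        + ∑ j, (∑ q, connMatrix Γ F α k q x * connMatrix Γ F β q j x) * W j x := by
    simp only [covDeriv, mul_add, Finset.sum_add_distrib, Finset.mul_sum, Finset.sum_mul]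
    congr 1
    rw [Finset.sum_comm]
    exact Finset.sum_congr rfl fun j _ => Finset.sum_congr rfl fun q _ => by ring
  rw [covDeriv, h1, h2]
  simp only [add_mul, Finset.sum_add_distrib]
  ring

/-- The Ricci identity. -/
lemma covDeriv_comm {W : Fin n → Eu m → ℝ} (hW : ∀ k, ContDiffOn ℝ ∞ (W k) U) {x : Eu m}
    (hx : x ∈ U) (α β : Fin m) (k : Fin n) :
    covDeriv Γ F α (covDeriv Γ F β W) k x
      = covDeriv Γ F β (covDeriv Γ F α W) k x
        + curvAlong Γ F (partialAlong F α) (partialAlong F β) W k x := by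
  have h1 : curvAlong Γ F (partialAlong F α) (partialAlong F β) W k x
      = ∑ j, (∑ l, ∑ i, curvComp Γ k l i j (F x) * partialAlong F α l x * partialAlong F β i x)
        * W j x := by
    simp only [curvAlong, Finset.sum_mul]
    rw [Finset.sum_comm' (t' := Finset.univ) (s' := fun _ => Finset.univ) (by simp)]
    rw [Finset.sum_congr rfl fun i _ => Finset.sum_comm]
    rw [Finset.sum_comm]
    refine Finset.sum_congr rfl fun j _ => ?_
    rw [Finset.sum_comm]
  rw [h1, P.covDeriv_covDeriv hW hx, P.covDeriv_covDeriv hW hx,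
    pd_comm P.isOpen_source hx (hW k) α β]
  simp only [← P.connMatrix_curvature hx]
  rw [add_assoc, add_assoc, add_assoc]
  congr 1
  simp only [← Finset.sum_add_distrib]
  refine Finset.sum_congr rfl fun j _ => ?_
  rw [Finset.sum_sub_distrib]
  ring

/-- The connection is compatible with the metric. -/
lemma pd_innerAlong {W Z : Fin n → Eu m → ℝ} (hW : ∀ k, ContDiffOn ℝ ∞ (W k) U)
    (hZ : ∀ k, ContDiffOn ℝ ∞ (Z k) U) {x : Eu m} (hx : x ∈ U) (α : Fin m) :
    pd α (innerAlong G F W Z) x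
      = innerAlong G F (covDeriv Γ F α W) Z x + innerAlong G F W (covDeriv Γ F α Z) x := by
  have hG : ∀ i j, DifferentiableAt ℝ (fun y => G i j (F y)) x := fun i j =>
    P.differentiableAt (P.contDiffOn_comp (P.contDiffOn_metric i j)) hx
  have hWd : ∀ j, DifferentiableAt ℝ (W j) x := fun j => P.differentiableAt (hW j) hx
  have hZd : ∀ j, DifferentiableAt ℝ (Z j) x := fun j => P.differentiableAt (hZ j) hx
  have h0 : innerAlong G F W Z = fun y => ∑ i, ∑ j, G i j (F y) * W i y * Z j y := rfl
  have hGα : ∀ i j, pd α (fun y => G i j (F y)) x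
      = ∑ p, (connMatrix Γ F α p i x * G p j (F x) + connMatrix Γ F α p j x * G i p (F x)) := by
    intro i j
    rw [pd_comp (P.differentiableAt_target (P.contDiffOn_metric i j) hx)
      (P.differentiableAt_map hx)]
    simp only [P.compatible _ i j _ (P.mapsTo hx), connMatrix, Finset.sum_mul,
      ← Finset.sum_add_distrib]
    rw [Finset.sum_comm]
    exact Finset.sum_congr rfl fun p _ => Finset.sum_congr rfl fun l _ => by ring
  have h1 : pd α (innerAlong G F W Z) x = ∑ i, ∑ j,
      ((∑ p, connMatrix Γ F α p i x * G p j (F x) * W i x * Z j x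
        + ∑ p, connMatrix Γ F α p j x * G i p (F x) * W i x * Z j x)
      + (G i j (F x) * pd α (W i) x * Z j x + G i j (F x) * W i x * pd α (Z j) x)) := by
    rw [h0, pd_sum fun i _ => DifferentiableAt.fun_sum fun j _ =>
      ((hG i j).fun_mul (hWd i)).fun_mul (hZd j)]
    refine Finset.sum_congr rfl fun i _ => ?_
    rw [pd_sum fun j _ => ((hG i j).fun_mul (hWd i)).fun_mul (hZd j)]
    refine Finset.sum_congr rfl fun j _ => ?_
    rw [pd_mul ((hG i j).fun_mul (hWd i)) (hZd j), pd_mul (hG i j) (hWd i), hGα,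
      Finset.sum_add_distrib]
    simp only [← Finset.sum_mul]
    ring
  have h2 : innerAlong G F (covDeriv Γ F α W) Z x
      = ∑ i, ∑ j, ∑ p, connMatrix Γ F α p i x * G p j (F x) * W i x * Z j x
        + ∑ i, ∑ j, G i j (F x) * pd α (W i) x * Z j x := by
    simp only [innerAlong, covDeriv, mul_add, add_mul, Finset.sum_add_distrib]
    rw [add_comm]
    congr 1
    simp only [Finset.mul_sum, Finset.sum_mul]
    rw [Finset.sum_comm]
    rw [Finset.sum_congr rfl fun j _ => Finset.sum_comm]
    rw [Finset.sum_comm]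
    exact Finset.sum_congr rfl fun j _ => Finset.sum_congr rfl fun p _ =>
      Finset.sum_congr rfl fun i _ => by ring
  have h3 : innerAlong G F W (covDeriv Γ F α Z) x
      = ∑ i, ∑ j, ∑ p, connMatrix Γ F α p j x * G i p (F x) * W i x * Z j x
        + ∑ i, ∑ j, G i j (F x) * W i x * pd α (Z j) x := by
    simp only [innerAlong, covDeriv, mul_add, Finset.sum_add_distrib]
    rw [add_comm]
    congr 1
    simp only [Finset.mul_sum]
    refine Finset.sum_congr rfl fun i _ => ?_
    rw [Finset.sum_comm]
    exact Finset.sum_congr rfl fun j _ => Finset.sum_congr rfl fun p _ => by ring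
  rw [h1, h2, h3]
  simp only [Finset.sum_add_distrib]
  ring

lemma innerAlong_comm (W Z : Fin n → Eu m → ℝ) {x : Eu m} (hx : x ∈ U) :
    innerAlong G F W Z x = innerAlong G F Z W x := by
  rw [innerAlong, Finset.sum_comm]
  refine Finset.sum_congr rfl fun i _ => Finset.sum_congr rfl fun j _ => ?_
  rw [P.metric_symm j i _ (P.mapsTo hx)]
  ring

end

/-! ### Linearity, and the Bochner formula for the radial field. -/

lemma innerAlong_sum_left {ι : Type*} [Fintype ι] (W : ι → Fin n → Eu m → ℝ)
    (Z : Fin n → Eu m → ℝ) (x : Eu m) :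
    innerAlong G F (fun k y => ∑ β, W β k y) Z x = ∑ β, innerAlong G F (W β) Z x := by
  simp only [innerAlong]
  symm
  rw [Finset.sum_comm]
  refine Finset.sum_congr rfl fun i _ => ?_
  rw [Finset.sum_comm]
  refine Finset.sum_congr rfl fun j _ => ?_
  rw [Finset.mul_sum, Finset.sum_mul]

lemma innerAlong_add_left (W W' Z : Fin n → Eu m → ℝ) (x : Eu m) :
    innerAlong G F (fun k y => W k y + W' k y) Z x
      = innerAlong G F W Z x + innerAlong G F W' Z x := by
  simp only [innerAlong, mul_add, add_mul, Finset.sum_add_distrib]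

lemma innerAlong_mul_left (g : Eu m → ℝ) (W Z : Fin n → Eu m → ℝ) (x : Eu m) :
    innerAlong G F (fun k y => g y * W k y) Z x = g x * innerAlong G F W Z x := by
  simp only [innerAlong, Finset.mul_sum]
  exact Finset.sum_congr rfl fun i _ => Finset.sum_congr rfl fun j _ => by ring

lemma innerAlong_congr {W W' Z Z' : Fin n → Eu m → ℝ} {x : Eu m} (h : ∀ k, W k x = W' k x)
    (h' : ∀ k, Z k x = Z' k x) : innerAlong G F W Z x = innerAlong G F W' Z' x := by
  simp only [innerAlong, h, h']

variable (P : IsChartMap G Γ F U Ω)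
include P

lemma covDeriv_add {W Z : Fin n → Eu m → ℝ} (hW : ∀ k, ContDiffOn ℝ ∞ (W k) U)
    (hZ : ∀ k, ContDiffOn ℝ ∞ (Z k) U) {x : Eu m} (hx : x ∈ U) (α : Fin m) (k : Fin n) :
    covDeriv Γ F α (fun k y => W k y + Z k y) k x
      = covDeriv Γ F α W k x + covDeriv Γ F α Z k x := by
  simp only [covDeriv, mul_add, Finset.sum_add_distrib]
  rw [pd_add (P.differentiableAt (hW k) hx) (P.differentiableAt (hZ k) hx)]
  ring

lemma covDeriv_const_mul {W : Fin n → Eu m → ℝ} (hW : ∀ k, ContDiffOn ℝ ∞ (W k) U) (a : ℝ)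
    {x : Eu m} (hx : x ∈ U) (α : Fin m) (k : Fin n) :
    covDeriv Γ F α (fun k y => a * W k y) k x = a * covDeriv Γ F α W k x := by
  have := P.covDeriv_sum_mul (ι := Unit) (g := fun _ _ => a) (W := fun _ => W)
    (fun _ => contDiffOn_const) (fun _ => hW) hx α k
  simpa [pd_const] using this

lemma covDeriv_sum_half_coord_mul {W : Fin m → Fin n → Eu m → ℝ}
    (hW : ∀ γ k, ContDiffOn ℝ ∞ (W γ k) U) {x : Eu m} (hx : x ∈ U) (β : Fin m) (k : Fin n) :
    covDeriv Γ F β (fun k y => ∑ γ, y γ / 2 * W γ k y) k x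
      = 1 / 2 * W β k x + ∑ γ, x γ / 2 * covDeriv Γ F β (W γ) k x := by
  rw [P.covDeriv_sum_mul (g := fun γ y => y γ / 2)
    (fun γ => ((contDiff_coord γ).div_const 2).contDiffOn) hW hx, Finset.sum_add_distrib]
  congr 1
  have h : ∀ γ, pd β (fun y : Eu m => y γ / 2) x = if γ = β then 1 / 2 else 0 := by
    intro γ
    simp only [div_eq_mul_inv]
    rw [pd_mul (differentiableAt_coord γ x) (differentiableAt_const _), pd_const, pd_coord]
    split_ifs <;> simp
  simp [h]

/-- Torsion-freeness exchanges `β` and `γ`, so that the second term is the derivative of `∂_β F` in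
the direction `x / 2`. -/
lemma covDeriv_radialAlong {x : Eu m} (hx : x ∈ U) (β : Fin m) (k : Fin n) :
    covDeriv Γ F β (radialAlong F) k x
      = 1 / 2 * partialAlong F β k x
        + ∑ γ, x γ / 2 * covDeriv Γ F γ (partialAlong F β) k x := by
  refine (P.covDeriv_sum_half_coord_mul P.contDiffOn_partialAlong hx β k).trans ?_
  simp only [P.covDeriv_partialAlong_comm hx β]

/-- Both derivatives hit the factor `x / 2` once, and the two halves add up to a full `∇_β ∂_β F`.
Moving `∇_β` past `∇_γ` costs a curvature term, which the weights `x γ / 2` contract to one in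
`radialAlong F`. Summed over `β`, the soliton equation applies to the first two terms. -/
lemma covDeriv_covDeriv_radialAlong {x : Eu m} (hx : x ∈ U) (β : Fin m) (k : Fin n) :
    covDeriv Γ F β (covDeriv Γ F β (radialAlong F)) k x
      = covDeriv Γ F β (partialAlong F β) k x
        + ∑ γ, x γ / 2 * covDeriv Γ F γ (covDeriv Γ F β (partialAlong F β)) k x
        + curvAlong Γ F (partialAlong F β) (radialAlong F) (partialAlong F β) k x := by
  have hp := P.contDiffOn_partialAlong
  have hpp : ∀ γ k, ContDiffOn ℝ ∞ (covDeriv Γ F γ (partialAlong F β) k) U := fun γ k =>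
    P.contDiffOn_covDeriv (hp β) γ k
  have hcurv : curvAlong Γ F (partialAlong F β) (radialAlong F) (partialAlong F β) k x
      = ∑ γ, x γ / 2 * curvAlong Γ F (partialAlong F β) (partialAlong F γ)
        (partialAlong F β) k x := by
    simp only [curvAlong, radialAlong, Finset.mul_sum, Finset.sum_mul]
    symm
    rw [Finset.sum_comm]
    refine Finset.sum_congr rfl fun i _ => ?_
    rw [Finset.sum_comm]
    refine Finset.sum_congr rfl fun j _ => ?_
    rw [Finset.sum_comm]
    exact Finset.sum_congr rfl fun a _ => Finset.sum_congr rfl fun γ _ => by ring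
  rw [P.covDeriv_congr (fun k y hy => P.covDeriv_radialAlong hy β k) hx,
    P.covDeriv_add (W := fun k y => 1 / 2 * partialAlong F β k y)
      (fun k => contDiffOn_const.mul (hp β k))
      (fun k => ContDiffOn.sum fun γ _ => ((contDiff_coord γ).div_const 2).contDiffOn.mul
        (hpp γ k)) hx,
    P.covDeriv_const_mul (hp β) _ hx, P.covDeriv_sum_half_coord_mul hpp hx, hcurv]
  simp only [P.covDeriv_comm (hp β) hx β, mul_add, Finset.sum_add_distrib]
  ring

/-- The Laplacian of the radial field of a soliton. -/
lemma sum_covDeriv_covDeriv_radialAlong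
    (hs : ∀ y ∈ U, ∀ k, ∑ β, covDeriv Γ F β (partialAlong F β) k y = radialAlong F k y)
    {x : Eu m} (hx : x ∈ U) (k : Fin n) :
    ∑ β, covDeriv Γ F β (covDeriv Γ F β (radialAlong F)) k x
      = radialAlong F k x + ∑ β, x β / 2 * covDeriv Γ F β (radialAlong F) k x
        + ∑ β, curvAlong Γ F (partialAlong F β) (radialAlong F) (partialAlong F β) k x := by
  have hpp : ∀ β k, ContDiffOn ℝ ∞ (covDeriv Γ F β (partialAlong F β) k) U := fun β k =>
    P.contDiffOn_covDeriv (P.contDiffOn_partialAlong β) β k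
  have h1 : ∀ γ, ∑ β, covDeriv Γ F γ (covDeriv Γ F β (partialAlong F β)) k x
      = covDeriv Γ F γ (radialAlong F) k x := fun γ => by
    rw [← P.covDeriv_sum hpp hx]
    exact P.covDeriv_congr (fun k y hy => hs y hy k) hx γ k
  simp only [P.covDeriv_covDeriv_radialAlong hx, Finset.sum_add_distrib, hs x hx k, ← h1,
    Finset.mul_sum]
  rw [Finset.sum_comm]

/-- The Bochner formula for the radial field of a soliton. -/
theorem driftLaplacian_innerAlong_radialAlong
    (hs : ∀ y ∈ U, ∀ k, ∑ β, covDeriv Γ F β (partialAlong F β) k y = radialAlong F k y)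
    {x : Eu m} (hx : x ∈ U) :
    driftLaplacian (innerAlong G F (radialAlong F) (radialAlong F)) x
      = 2 * ∑ β, innerAlong G F (covDeriv Γ F β (radialAlong F)) (covDeriv Γ F β (radialAlong F)) x
        + 2 * innerAlong G F (radialAlong F) (radialAlong F) x
        + 2 * ∑ β, innerAlong G F
          (curvAlong Γ F (partialAlong F β) (radialAlong F) (partialAlong F β))
          (radialAlong F) x := by
  set V := radialAlong F with hVdef
  have hV : ∀ k, ContDiffOn ℝ ∞ (V k) U := P.contDiffOn_radialAlong
  have hDV : ∀ β k, ContDiffOn ℝ ∞ (covDeriv Γ F β V k) U := P.contDiffOn_covDeriv hV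
  have h1 : ∀ β, ∀ y ∈ U, pd β (innerAlong G F V V) y
      = 2 * innerAlong G F (covDeriv Γ F β V) V y := fun β y hy => by
    rw [P.pd_innerAlong hV hV hy, P.innerAlong_comm V _ hy]
    ring
  have h2 : ∀ β, pd β (pd β (innerAlong G F V V)) x
      = 2 * (innerAlong G F (covDeriv Γ F β (covDeriv Γ F β V)) V x
        + innerAlong G F (covDeriv Γ F β V) (covDeriv Γ F β V) x) := fun β => by
    rw [P.pd_congr_on (h1 β) hx, pd_mul (differentiableAt_const _)
      (P.differentiableAt (P.contDiffOn_innerAlong (hDV β) hV) hx), pd_const,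
      P.pd_innerAlong (hDV β) hV hx]
    ring
  have h3 : ∑ β, innerAlong G F (covDeriv Γ F β (covDeriv Γ F β V)) V x
      = innerAlong G F V V x + ∑ β, x β / 2 * innerAlong G F (covDeriv Γ F β V) V x
        + ∑ β, innerAlong G F (curvAlong Γ F (partialAlong F β) V (partialAlong F β)) V x := by
    -- `innerAlong` only reads values at `x`, so the coefficients `x β / 2` may be frozen there and
    -- treated as constants.
    have e1 := innerAlong_congr (G := G) (F := F) (Z := V) (Z' := V)
      (W := fun k y => ∑ β, covDeriv Γ F β (covDeriv Γ F β V) k y)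
      (W' := fun k y => V k y + ∑ β, x β / 2 * covDeriv Γ F β V k y
        + ∑ β, curvAlong Γ F (partialAlong F β) V (partialAlong F β) k y)
      (fun k => P.sum_covDeriv_covDeriv_radialAlong hs hx k) (fun _ => rfl)
    rw [innerAlong_sum_left] at e1
    rw [e1, innerAlong_add_left (fun k y => V k y + ∑ β, x β / 2 * covDeriv Γ F β V k y),
      innerAlong_add_left, innerAlong_sum_left, innerAlong_sum_left]
    simp only [innerAlong_mul_left fun _ => _]
  simp only [driftLaplacian, h2, h1 _ x hx, Finset.sum_sub_distrib, ← Finset.mul_sum,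
    Finset.sum_add_distrib, h3]
  rw [Finset.sum_congr rfl fun β _ => mul_left_comm (x β / 2) 2 _, ← Finset.mul_sum]
  ring

end IsChartMap

end AlongMap

/-! ### The metric and the Levi-Civita connection in a chart -/

lemma contDiffOn_det {k l : ℕ} {s : Set (Eu k)} {A : Eu k → Matrix (Fin l) (Fin l) ℝ}
    (hA : ∀ i j, ContDiffOn ℝ ∞ (fun y => A y i j) s) : ContDiffOn ℝ ∞ (fun y => (A y).det) s := by
  simp only [Matrix.det_apply]
  exact ContDiffOn.sum fun σ _ => (contDiffOn_prod fun i _ => hA _ _).const_smul _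

/-- Cramer's rule: the entries of the inverse are quotients of determinants. -/
lemma contDiffOn_matrix_inv {k l : ℕ} {s : Set (Eu k)} {A : Eu k → Matrix (Fin l) (Fin l) ℝ}
    (hA : ∀ i j, ContDiffOn ℝ ∞ (fun y => A y i j) s) (hdet : ∀ y ∈ s, (A y).det ≠ 0)
    (i j : Fin l) : ContDiffOn ℝ ∞ (fun y => (A y)⁻¹ i j) s := by
  simp only [Matrix.inv_def, Ring.inverse_eq_inv', Matrix.smul_apply, Matrix.adjugate_apply,
    smul_eq_mul]
  refine ((contDiffOn_det hA).inv hdet).mul (contDiffOn_det fun a b => ?_)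
  by_cases h : a = j
  · simp only [h, Matrix.updateRow_self]
    exact contDiffOn_const
  · simp only [Matrix.updateRow_ne h]
    exact hA a b

section Chart

variable {m n : ℕ} {N : Type*} [TopologicalSpace N] [ChartedSpace (Eu n) N]
  [IsManifold (𝓡 n) ∞ N] (h : RMetric n N) {c : OpenPartialHomeomorph N (Eu n)}

lemma contMDiffOn_chart (hc : c ∈ atlas (Eu n) N) : ContMDiffOn (𝓡 n) (𝓡 n) ∞ c c.source :=
  contMDiffOn_of_mem_maximalAtlas (IsManifold.subset_maximalAtlas hc)

lemma contMDiffOn_chart_symm (hc : c ∈ atlas (Eu n) N) :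
    ContMDiffOn (𝓡 n) (𝓡 n) ∞ c.symm c.target :=
  contMDiffOn_symm_of_mem_maximalAtlas (IsManifold.subset_maximalAtlas hc)

/-- The coordinate field is the image of a constant section under the tangent map of `c.symm`. -/
lemma contMDiffOn_coordField (hc : c ∈ atlas (Eu n) N) (i : Fin n) :
    ContMDiffOn (𝓡 n) (𝓡 n).tangent ∞
      (fun y => (⟨c.symm y, coordField c i y⟩ : TangentBundle (𝓡 n) N)) c.target := by
  have h1 := (contMDiffOn_chart_symm hc).contMDiffOn_tangentMapWithin (m := ∞) le_rfl
    c.open_target.uniqueMDiffOn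
  have h2 : ContMDiff (𝓡 n) (𝓡 n).tangent ∞
      (fun y : Eu n => (⟨y, stdVec i⟩ : TangentBundle (𝓡 n) (Eu n))) :=
    contMDiff_vectorSpace_iff_contDiff.2 contDiff_const
  refine (h1.comp h2.contMDiffOn (fun y hy => hy)).congr fun y hy => ?_
  simp only [Function.comp_apply, tangentMapWithin, coordField]
  rw [mfderivWithin_of_isOpen c.open_target hy]

lemma contDiffOn_metricCoeff (hc : c ∈ atlas (Eu n) N) (i j : Fin n) :
    ContDiffOn ℝ ∞ (metricCoeff h c i j) c.target := by
  rw [← contMDiffOn_iff_contDiffOn]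
  intro y hy
  have h1 : ContMDiffWithinAt (𝓡 n) ((𝓡 n).prod 𝓘(ℝ)) ∞
      (fun y => Bundle.TotalSpace.mk' ℝ (E := Bundle.Trivial N ℝ) (c.symm y)
        (h.inner (c.symm y) (coordField c i y) (coordField c j y))) c.target y := by
    apply ContMDiffWithinAt.clm_bundle_apply₂ (F₁ := Eu n) (F₂ := Eu n)
    · exact ContMDiffAt.comp_contMDiffWithinAt y h.contMDiff.contMDiffAt
        (contMDiffOn_chart_symm hc y hy)
    · exact contMDiffOn_coordField hc i y hy
    · exact contMDiffOn_coordField hc j y hy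
  simp only [Bundle.contMDiffWithinAt_totalSpace] at h1
  exact h1.2

lemma metricCoeff_symm (i j : Fin n) (y : Eu n) : metricCoeff h c i j y = metricCoeff h c j i y :=
  h.symm _ _ _

lemma innerCoord_eq_inner (y : Eu n) (u v : Eu n) :
    innerCoord h c y u v
      = h.inner (c.symm y) (mfderiv (𝓡 n) (𝓡 n) c.symm y u) (mfderiv (𝓡 n) (𝓡 n) c.symm y v) := by
  have hw : ∀ w : Eu n, mfderiv (𝓡 n) (𝓡 n) c.symm y w = ∑ i, w i • coordField c i y := by
    intro w
    have hw : w = ∑ i, w i • stdVec i := by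
      ext j
      simp [stdVec, Pi.single_apply]
    conv_lhs => rw [hw]
    exact map_sum (mfderiv (𝓡 n) (𝓡 n) c.symm y) _ _ |>.trans
      (Finset.sum_congr rfl fun i _ => map_smul (mfderiv (𝓡 n) (𝓡 n) c.symm y) _ _)
  rw [hw u, hw v]
  simp only [map_sum, map_smul, sum_apply, smul_apply,
    innerCoord, smul_eq_mul, metricCoeff, Finset.mul_sum]
  rw [Finset.sum_comm]
  exact Finset.sum_congr rfl fun i _ => Finset.sum_congr rfl fun j _ => by ring

lemma mfderiv_chart_symm_injective (hc : c ∈ atlas (Eu n) N) {y : Eu n} (hy : y ∈ c.target) :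
    Function.Injective (mfderiv (𝓡 n) (𝓡 n) c.symm y) :=
  (mdifferentiable_of_mem_atlas (I := 𝓡 n) hc).symm.mfderiv_injective (x := y) hy

lemma innerCoord_self_pos (hc : c ∈ atlas (Eu n) N) {y : Eu n} (hy : y ∈ c.target)
    {u : Fin n → ℝ} (hu : u ≠ 0) : 0 < innerCoord h c y u u := by
  have := innerCoord_eq_inner h (c := c) y (WithLp.toLp 2 u) (WithLp.toLp 2 u)
  refine lt_of_lt_of_eq (h.pos _ _ fun h0 => hu ?_) this.symm
  have h1 := mfderiv_chart_symm_injective hc hy (h0.trans (map_zero _).symm)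
  exact congrArg WithLp.ofLp h1

lemma innerCoord_self_nonneg (hc : c ∈ atlas (Eu n) N) {y : Eu n} (hy : y ∈ c.target)
    (u : Fin n → ℝ) : 0 ≤ innerCoord h c y u u := by
  rcases eq_or_ne u 0 with rfl | hu
  · simp [innerCoord]
  · exact (innerCoord_self_pos h hc hy hu).le

/-- A null vector of the matrix would be a nonzero tangent vector of length zero. -/
lemma det_metricCoeff_ne_zero (hc : c ∈ atlas (Eu n) N) {y : Eu n} (hy : y ∈ c.target) :
    (Matrix.of fun a b => metricCoeff h c a b y).det ≠ 0 := by
  intro h0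
  obtain ⟨v, hv, hv0⟩ := Matrix.exists_mulVec_eq_zero_iff.2 h0
  refine (innerCoord_self_pos h hc hy hv).ne' ?_
  have h1 : ∀ i, ∑ j, metricCoeff h c i j y * v j = 0 := fun i => congrFun hv0 i
  have h2 : innerCoord h c y v v = ∑ i, v i * ∑ j, metricCoeff h c i j y * v j := by
    simp only [innerCoord, Finset.mul_sum]
    exact Finset.sum_congr rfl fun i _ => Finset.sum_congr rfl fun j _ => by ring
  simp [h2, h1]

lemma sum_metricCoeff_mul_invMetricCoeff (hc : c ∈ atlas (Eu n) N) {y : Eu n} (hy : y ∈ c.target)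
    (i l : Fin n) :
    ∑ p, metricCoeff h c i p y * invMetricCoeff h c p l y = if i = l then 1 else 0 := by
  have := Matrix.mul_nonsing_inv (Matrix.of fun a b => metricCoeff h c a b y)
    (det_metricCoeff_ne_zero h hc hy).isUnit
  simpa [Matrix.mul_apply, Matrix.one_apply, invMetricCoeff] using congrFun (congrFun this i) l

lemma contDiffOn_christoffel (hc : c ∈ atlas (Eu n) N) (k i j : Fin n) :
    ContDiffOn ℝ ∞ (christoffel h c k i j) c.target := by
  have hG := contDiffOn_metricCoeff h hc
  have hI : ∀ l, ContDiffOn ℝ ∞ (invMetricCoeff h c k l) c.target := fun l =>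
    contDiffOn_matrix_inv (A := fun y => Matrix.of fun a b => metricCoeff h c a b y)
      (fun a b => hG a b) (fun y hy => det_metricCoeff_ne_zero h hc hy) k l
  refine contDiffOn_const.mul (ContDiffOn.sum fun l _ => (hI l).mul ?_)
  exact ((contDiffOn_pd c.open_target (hG j l) i).add
    (contDiffOn_pd c.open_target (hG i l) j)).sub (contDiffOn_pd c.open_target (hG i j) l)

/-! ### Symmetry and metric compatibility of the Levi-Civita connection. -/

lemma pd_metricCoeff_symm (l i j : Fin n) (y : Eu n) :
    pd l (metricCoeff h c i j) y = pd l (metricCoeff h c j i) y := by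
  rw [show metricCoeff h c i j = metricCoeff h c j i from funext (metricCoeff_symm h i j)]

lemma christoffel_symm (k i j : Fin n) (y : Eu n) :
    christoffel h c k i j y = christoffel h c k j i y := by
  simp only [christoffel]
  congr 1
  refine Finset.sum_congr rfl fun l _ => ?_
  rw [pd_metricCoeff_symm h l i j]
  ring

lemma sum_metricCoeff_mul_christoffel (hc : c ∈ atlas (Eu n) N) {y : Eu n} (hy : y ∈ c.target)
    (i j q : Fin n) :
    ∑ p, metricCoeff h c q p y * christoffel h c p i j y
      = 1 / 2 * (pd i (metricCoeff h c j q) y + pd j (metricCoeff h c i q) y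
        - pd q (metricCoeff h c i j) y) := by
  have h1 : ∑ p, metricCoeff h c q p y * christoffel h c p i j y
      = ∑ l, (∑ p, metricCoeff h c q p y * invMetricCoeff h c p l y) *
        (1 / 2 * (pd i (metricCoeff h c j l) y + pd j (metricCoeff h c i l) y
        - pd l (metricCoeff h c i j) y)) := by
    simp only [christoffel, Finset.mul_sum, Finset.sum_mul]
    rw [Finset.sum_comm]
    exact Finset.sum_congr rfl fun l _ => Finset.sum_congr rfl fun p _ => by ring
  rw [h1]
  simp [sum_metricCoeff_mul_invMetricCoeff h hc hy]

/-- Lowering the index gives two Christoffel symbols of the first kind; in their sum everything but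
`∂_l h_{ij}` cancels. -/
lemma pd_metricCoeff (hc : c ∈ atlas (Eu n) N) {y : Eu n} (hy : y ∈ c.target) (l i j : Fin n) :
    pd l (metricCoeff h c i j) y = ∑ p, (christoffel h c p l i y * metricCoeff h c p j y
      + christoffel h c p l j y * metricCoeff h c i p y) := by
  have h1 : ∀ p, christoffel h c p l i y * metricCoeff h c p j y
      + christoffel h c p l j y * metricCoeff h c i p y
      = metricCoeff h c j p y * christoffel h c p l i y
        + metricCoeff h c i p y * christoffel h c p l j y := fun p => by
    rw [metricCoeff_symm h p j]; ring
  simp only [h1, Finset.sum_add_distrib, sum_metricCoeff_mul_christoffel h hc hy]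
  rw [pd_metricCoeff_symm h i l j, pd_metricCoeff_symm h j l i, pd_metricCoeff_symm h i j l,
    pd_metricCoeff_symm h j i l, pd_metricCoeff_symm h l j i]
  ring

/-! ### Curvature bounds -/

lemma innerCoord_comm (y : Eu n) (u v : Fin n → ℝ) :
    innerCoord h c y u v = innerCoord h c y v u := by
  rw [innerCoord, Finset.sum_comm]
  refine Finset.sum_congr rfl fun i _ => Finset.sum_congr rfl fun j _ => ?_
  rw [metricCoeff_symm h j i]
  ring

lemma curvCoord_swap (y : Eu n) (u v w : Fin n → ℝ) (l : Fin n) :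
    curvCoord h c y u v w l = - curvCoord h c y v u w l := by
  rw [curvCoord, Finset.sum_comm, curvCoord]
  simp only [← Finset.sum_neg_distrib]
  refine Finset.sum_congr rfl fun i _ => Finset.sum_congr rfl fun j _ =>
    Finset.sum_congr rfl fun k _ => ?_
  have : curvCoeff h c l j i k y = - curvCoeff h c l i j k y := by
    rw [curvCoeff, curvCoeff, neg_add, ← Finset.sum_neg_distrib]
    congr 1
    · ring
    · exact Finset.sum_congr rfl fun p _ => by ring
  rw [this]
  ring

lemma curvCoord_self (y : Eu n) (u w : Fin n → ℝ) (l : Fin n) :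
    curvCoord h c y u u w l = 0 := by
  have := curvCoord_swap h (c := c) y u u w l
  linarith

lemma curvCoord_smul_left (a : ℝ) (y : Eu n) (u v w : Fin n → ℝ) (l : Fin n) :
    curvCoord h c y (a • u) v w l = a * curvCoord h c y u v w l := by
  simp only [curvCoord, Finset.mul_sum, Pi.smul_apply, smul_eq_mul]
  exact Finset.sum_congr rfl fun i _ => Finset.sum_congr rfl fun j _ =>
    Finset.sum_congr rfl fun k _ => by ring

lemma innerCoord_sub_smul_self (y : Eu n) (a b : ℝ) (u v : Fin n → ℝ) :
    innerCoord h c y (a • u - b • v) (a • u - b • v)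
      = a ^ 2 * innerCoord h c y u u - 2 * a * b * innerCoord h c y u v
        + b ^ 2 * innerCoord h c y v v := by
  have h1 : innerCoord h c y (a • u - b • v) (a • u - b • v)
      = a ^ 2 * innerCoord h c y u u - a * b * innerCoord h c y u v
        - a * b * innerCoord h c y v u + b ^ 2 * innerCoord h c y v v := by
    simp only [innerCoord, Finset.mul_sum, ← Finset.sum_sub_distrib, ← Finset.sum_add_distrib,
      Pi.sub_apply, Pi.smul_apply, smul_eq_mul]
    exact Finset.sum_congr rfl fun i _ => Finset.sum_congr rfl fun j _ => by ring
  rw [h1, innerCoord_comm h y v u]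
  ring

/-- The sectional curvature bound only concerns independent pairs, whose Gram determinant is
positive. For dependent pairs the curvature vector vanishes by antisymmetry, and `0 ≤ K` settles the
inequality. -/
lemma innerCoord_curvCoord_le {K : ℝ} (hK : SectionalCurvatureLE h K) (hK0 : 0 ≤ K)
    (hc : c ∈ atlas (Eu n) N) {y : Eu n} (hy : y ∈ c.target) (u v : Fin n → ℝ) :
    innerCoord h c y (curvCoord h c y u v v) u
      ≤ K * (innerCoord h c y u u * innerCoord h c y v v - innerCoord h c y u v ^ 2) := by
  have hpos := fun w => innerCoord_self_nonneg h hc hy w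
  set A := innerCoord h c y v v with hA
  set B := innerCoord h c y u v with hB
  set C := innerCoord h c y u u with hC
  -- `‖A u - B v‖² = A (A C - B²)`
  have hid : innerCoord h c y (A • u - B • v) (A • u - B • v) = A * (C * A - B ^ 2) := by
    rw [innerCoord_sub_smul_self]
    ring
  by_cases hli : LinearIndependent ℝ ![u, v]
  · have hv : v ≠ 0 := by simpa using hli.ne_zero 1
    have hA0 : 0 < A := innerCoord_self_pos h hc hy hv
    have hne : A • u - B • v ≠ 0 := fun h0 => by
      have := LinearIndependent.pair_iff.1 hli A (-B) (by simpa [sub_eq_add_neg] using h0)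
      exact hA0.ne' this.1
    have hd : 0 < C * A - B ^ 2 := by
      have := innerCoord_self_pos h hc hy hne
      rw [hid] at this
      exact pos_of_mul_pos_right this hA0.le
    have := hK c hc y hy u v hli
    rwa [sectionalCurvature, div_le_iff₀ hd] at this
  · have hzero : curvCoord h c y u v v = 0 ∧ 0 ≤ C * A - B ^ 2 := by
      rcases eq_or_ne v 0 with rfl | hv
      · constructor
        · ext l; simp [curvCoord]
        · simp [hA, hB, innerCoord]
      · have hA0 : 0 < A := innerCoord_self_pos h hc hy hv
        refine ⟨?_, ?_⟩
        · have : ∃ a : ℝ, a • v = u := by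
            by_contra! hn
            exact hli (LinearIndependent.pair_symm_iff.1 ((LinearIndependent.pair_iff' hv).2 hn))
          obtain ⟨a, rfl⟩ := this
          ext l
          rw [curvCoord_smul_left, curvCoord_self, mul_zero]; rfl
        · have := hpos (A • u - B • v)
          rw [hid] at this
          exact nonneg_of_mul_nonneg_right this hA0
    rw [hzero.1]
    have : innerCoord h c y 0 u = 0 := by simp [innerCoord]
    rw [this]
    exact mul_nonneg hK0 hzero.2

end Chart

/-! ### Solitons -/

/-- Cauchy–Schwarz in Lagrange's form: sum the nonnegativity of `B` on `a j • w i - a i • w j` over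
all pairs. It yields `radialEnergy_le`. -/
lemma bilin_sum_smul_self_le {E ι : Type*} [AddCommGroup E] [Module ℝ E] [Fintype ι]
    (B : E →ₗ[ℝ] E →ₗ[ℝ] ℝ) (hB : ∀ v, 0 ≤ B v v) (a : ι → ℝ) (w : ι → E) :
    B (∑ i, a i • w i) (∑ i, a i • w i) ≤ (∑ i, a i ^ 2) * ∑ i, B (w i) (w i) := by
  have h1 : B (∑ i, a i • w i) (∑ i, a i • w i) = ∑ i, ∑ j, a i * a j * B (w i) (w j) := by
    simp only [map_sum, map_smul, LinearMap.sum_apply, LinearMap.smul_apply, smul_eq_mul,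
      Finset.mul_sum]
    rw [Finset.sum_comm]
    exact Finset.sum_congr rfl fun i _ => Finset.sum_congr rfl fun j _ => by ring
  have h2 : ∀ i j, a i * a j * B (w i) (w j) + a j * a i * B (w j) (w i)
      ≤ a i ^ 2 * B (w j) (w j) + a j ^ 2 * B (w i) (w i) := fun i j => by
    have := hB (a j • w i - a i • w j)
    simp only [map_sub, map_smul, LinearMap.sub_apply, LinearMap.smul_apply, smul_eq_mul] at this
    linarith
  have h3 := Finset.sum_le_sum fun i (_ : i ∈ Finset.univ) =>
    Finset.sum_le_sum fun j (_ : j ∈ Finset.univ) => h2 i j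
  simp only [Finset.sum_add_distrib] at h3
  rw [Finset.sum_comm (f := fun i j => a j * a i * B (w j) (w i)),
    Finset.sum_comm (f := fun i j => a j ^ 2 * B (w i) (w i))] at h3
  rw [h1, Finset.sum_mul_sum]
  linarith

section Soliton

variable {m n : ℕ} {N : Type*} [TopologicalSpace N] [ChartedSpace (Eu n) N]
  [IsManifold (𝓡 n) ∞ N] (h : RMetric n N) {c : OpenPartialHomeomorph N (Eu n)} {f : Eu m → N}

/-- The squared length of `Tf (x / 2)`. -/
def radialEnergy (f : Eu m → N) (x : Eu m) : ℝ :=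
  h.inner (f x) (mfderiv (𝓡 m) (𝓡 n) f x ((1 / 2 : ℝ) • x))
    (mfderiv (𝓡 m) (𝓡 n) f x ((1 / 2 : ℝ) • x))

/-! ### Energy densities and their expressions in charts. -/

lemma inner_self_nonneg (p : N) (v : TangentSpace (𝓡 n) p) : 0 ≤ h.inner p v v := by
  rcases eq_or_ne v 0 with rfl | hv
  · simp
  · exact (h.pos p v hv).le

lemma normSqDifferential_nonneg (f : Eu m → N) (x : Eu m) : 0 ≤ normSqDifferential h f x :=
  Finset.sum_nonneg fun _ _ => inner_self_nonneg h _ _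

lemma radialEnergy_nonneg (f : Eu m → N) (x : Eu m) : 0 ≤ radialEnergy h f x :=
  inner_self_nonneg h _ _

lemma radialEnergy_le (f : Eu m → N) (x : Eu m) :
    radialEnergy h f x ≤ ‖x‖ ^ 2 / 4 * normSqDifferential h f x := by
  let B : Eu n →ₗ[ℝ] Eu n →ₗ[ℝ] ℝ := LinearMap.mk₂ ℝ (fun u v : Eu n => h.inner (f x) u v)
    (fun u u' v => congrArg (fun T => T v) (map_add (h.inner (f x)) u u'))
    (fun a u v => congrArg (fun T => T v) (map_smul (h.inner (f x)) a u))
    (fun u v v' => map_add (h.inner (f x) u) v v')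
    (fun a u v => map_smul (h.inner (f x) u) a v)
  let T : Eu m →ₗ[ℝ] Eu n := (mfderiv (𝓡 m) (𝓡 n) f x).toLinearMap
  have hx : (1 / 2 : ℝ) • x = ∑ i, (x i / 2) • stdVec i := by
    ext j
    simp [stdVec, Pi.single_apply]
    ring
  have h1 : T ((1 / 2 : ℝ) • x) = ∑ i, (x i / 2) • T (stdVec i) := by
    rw [hx, map_sum]
    simp only [map_smul]
  have h2 : ∑ i, (x i / 2) ^ 2 = ‖x‖ ^ 2 / 4 := by
    rw [EuclideanSpace.norm_sq_eq, Finset.sum_div]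
    exact Finset.sum_congr rfl fun i _ => by rw [Real.norm_eq_abs, sq_abs]; ring
  have h3 := bilin_sum_smul_self_le B (fun v => inner_self_nonneg h (f x) v)
    (fun i => x i / 2) (fun i => T (stdVec i))
  rw [← h1, h2] at h3
  exact h3

lemma isChartMap (hf : ContMDiff (𝓡 m) (𝓡 n) ∞ f) (hc : c ∈ atlas (Eu n) N) :
    IsChartMap (metricCoeff h c) (christoffel h c) (fun x => c (f x)) (f ⁻¹' c.source)
      c.target where
  isOpen_source := c.open_source.preimage hf.continuous
  isOpen_target := c.open_target
  mapsTo _ hx := c.map_source hx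
  contDiffOn := contMDiffOn_iff_contDiffOn.1
    ((contMDiffOn_chart hc).comp hf.contMDiffOn fun _ hx => hx)
  contDiffOn_metric := contDiffOn_metricCoeff h hc
  contDiffOn_christoffel := contDiffOn_christoffel h hc
  metric_symm i j y _ := metricCoeff_symm h i j y
  christoffel_symm k i j y _ := christoffel_symm h k i j y
  compatible l i j _ hy := pd_metricCoeff h hc hy l i j

/-- Needed because `f x` and `c.symm (c (f x))` are only propositionally equal, while all tangent
spaces unfold to `Eu n`. -/
lemma inner_congr_point {p q : N} (hpq : p = q) (u v : Eu n) :
    h.inner p (u : TangentSpace (𝓡 n) p) v = h.inner q (u : TangentSpace (𝓡 n) q) v := by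
  subst hpq
  rfl

lemma inner_mfderiv (hf : ContMDiff (𝓡 m) (𝓡 n) ∞ f) (hc : c ∈ atlas (Eu n) N) {x : Eu m}
    (hx : f x ∈ c.source) (u v : Eu m) :
    h.inner (f x) (mfderiv (𝓡 m) (𝓡 n) f x u) (mfderiv (𝓡 m) (𝓡 n) f x v)
      = innerCoord h c (c (f x)) (fderiv ℝ (fun y => c (f y)) x u)
        (fderiv ℝ (fun y => c (f y)) x v) := by
  have hF := (isChartMap h hf hc).differentiableAt_map hx
  have h1 : ∀ w : Eu m, (mfderiv (𝓡 m) (𝓡 n) f x w : Eu n)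
      = mfderiv (𝓡 n) (𝓡 n) c.symm (c (f x)) (fderiv ℝ (fun y => c (f y)) x w) := by
    intro w
    have e1 : c.symm ∘ (fun y => c (f y)) =ᶠ[𝓝 x] f :=
      Filter.eventuallyEq_of_mem ((c.open_source.preimage hf.continuous).mem_nhds hx)
        fun y hy => c.left_inv hy
    have e2 := mfderiv_comp (I := 𝓡 m) (I' := 𝓡 n) (I'' := 𝓡 n) x (g := c.symm)
      (f := fun y => c (f y))
      ((mdifferentiable_of_mem_atlas (I := 𝓡 n) hc).mdifferentiableAt_symm (c.map_source hx))
      hF.mdifferentiableAt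
    rw [mfderiv_eq_fderiv] at e2
    have e3 := congrArg (fun T : Eu m →L[ℝ] Eu n => T w) (e1.mfderiv_eq (I := 𝓡 m) (I' := 𝓡 n))
    have e4 := congrArg (fun T : Eu m →L[ℝ] Eu n => T w) e2
    exact e3.symm.trans e4
  rw [innerCoord_eq_inner]
  refine Eq.trans ?_ (inner_congr_point h (c.left_inv hx).symm _ _)
  exact congrArg₂ (fun a b : Eu n => h.inner (f x) a b) (h1 u) (h1 v)

lemma normSqDifferential_eq (hf : ContMDiff (𝓡 m) (𝓡 n) ∞ f) (hc : c ∈ atlas (Eu n) N) {x : Eu m}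
    (hx : f x ∈ c.source) :
    normSqDifferential h f x = ∑ β, innerAlong (metricCoeff h c) (fun y => c (f y))
      (partialAlong (fun y => c (f y)) β) (partialAlong (fun y => c (f y)) β) x := by
  refine Finset.sum_congr rfl fun β _ => ?_
  rw [inner_mfderiv h hf hc hx]
  have hF := (isChartMap h hf hc).differentiableAt_map hx
  simp only [← fderiv_component hF, innerCoord]
  rfl

lemma radialEnergy_eq (hf : ContMDiff (𝓡 m) (𝓡 n) ∞ f) (hc : c ∈ atlas (Eu n) N) {x : Eu m}
    (hx : f x ∈ c.source) :
    radialEnergy h f x = innerAlong (metricCoeff h c) (fun y => c (f y))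
      (radialAlong fun y => c (f y)) (radialAlong fun y => c (f y)) x := by
  rw [radialEnergy, inner_mfderiv h hf hc hx]
  have hF := (isChartMap h hf hc).differentiableAt_map hx
  have h1 : ∀ k, fderiv ℝ (fun y => c (f y)) x ((1 / 2 : ℝ) • x) k
      = radialAlong (fun y => c (f y)) k x := fun k => by
    rw [← fderiv_component hF, fderiv_eq_sum_pd]
    refine Finset.sum_congr rfl fun γ _ => ?_
    simp only [PiLp.smul_apply, smul_eq_mul, partialAlong]
    ring
  simp only [innerCoord, h1]
  rfl

lemma contDiff_radialEnergy (hf : ContMDiff (𝓡 m) (𝓡 n) ∞ f) :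
    ContDiff ℝ ∞ (radialEnergy h f) := by
  refine contDiff_iff_contDiffAt.2 fun x => ?_
  have hc := chart_mem_atlas (Eu n) (f x)
  have P := isChartMap h hf hc
  have hU := P.isOpen_source.mem_nhds (mem_chart_source (Eu n) (f x))
  exact ((P.contDiffOn_innerAlong P.contDiffOn_radialAlong P.contDiffOn_radialAlong).contDiffAt
    hU).congr_of_eventuallyEq
    (Filter.eventuallyEq_of_mem hU fun y hy => radialEnergy_eq h hf hc hy)

lemma continuous_normSqDifferential (hf : ContMDiff (𝓡 m) (𝓡 n) ∞ f) :
    Continuous (normSqDifferential h f) := by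
  refine continuous_iff_continuousAt.2 fun x => ?_
  have hc := chart_mem_atlas (Eu n) (f x)
  have P := isChartMap h hf hc
  have hU := P.isOpen_source.mem_nhds (mem_chart_source (Eu n) (f x))
  have h1 := (ContDiffOn.sum fun β (_ : β ∈ Finset.univ) => P.contDiffOn_innerAlong
    (P.contDiffOn_partialAlong β) (P.contDiffOn_partialAlong β)).contDiffAt hU
  refine h1.continuousAt.congr ?_
  exact Filter.eventuallyEq_of_mem hU fun y hy => (normSqDifferential_eq h hf hc hy).symm

variable {h}

/-! ### Vanishing of the radial energy of a soliton. -/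

lemma IsSoliton.sum_covDeriv_partialAlong (hf : IsSoliton h f) (hc : c ∈ atlas (Eu n) N)
    {x : Eu m} (hx : f x ∈ c.source) (k : Fin n) :
    ∑ β, covDeriv (christoffel h c) (fun y => c (f y)) β (partialAlong (fun y => c (f y)) β) k x
      = radialAlong (fun y => c (f y)) k x := by
  refine Eq.trans ?_ (hf.tension_eq c hc x hx k)
  refine Finset.sum_congr rfl fun β _ => ?_
  rw [covDeriv, Finset.sum_comm]
  simp only [connMatrix, Finset.sum_mul]
  rfl

/-- The Bochner formula with `|∇V|²` dropped and the curvature bound inserted. The sum of squares is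
kept: it is what decides the points where `K|Tf|² = 1`. -/
lemma IsSoliton.le_driftLaplacian_radialEnergy (hf : IsSoliton h f) {K : ℝ} (hK0 : 0 ≤ K)
    (hK : SectionalCurvatureLE h K) (hc : c ∈ atlas (Eu n) N) {x : Eu m} (hx : f x ∈ c.source) :
    2 * radialEnergy h f x * (1 - K * normSqDifferential h f x)
        + 2 * K * ∑ β, innerAlong (metricCoeff h c) (fun y => c (f y))
          (radialAlong fun y => c (f y)) (partialAlong (fun y => c (f y)) β) x ^ 2
      ≤ driftLaplacian (radialEnergy h f) x := by
  have P := isChartMap h hf.smooth hc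
  set F := fun y => c (f y) with hFdef
  set V := radialAlong F with hV
  have hy : F x ∈ c.target := P.mapsTo hx
  have hcongr : driftLaplacian (radialEnergy h f) x
      = driftLaplacian (innerAlong (metricCoeff h c) F V V) x := by
    have h1 : ∀ y ∈ f ⁻¹' c.source, radialEnergy h f y = innerAlong (metricCoeff h c) F V V y :=
      fun y hy => radialEnergy_eq h hf.smooth hc hy
    refine Finset.sum_congr rfl fun α _ => ?_
    rw [P.pd_congr_on h1 hx, P.pd_congr_on (fun y hy => P.pd_congr_on h1 hy α) hx]
  -- Swapping the first two slots of `R` produces the numerator of the sectional curvature, with a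
  -- minus sign, so an upper curvature bound becomes a lower bound here.
  have hcurv : ∀ β, innerAlong (metricCoeff h c) F
      (curvAlong (christoffel h c) F (partialAlong F β) V (partialAlong F β)) V x
      = - innerCoord h c (F x) (curvCoord h c (F x) (fun k => V k x)
        (fun k => partialAlong F β k x) (fun k => partialAlong F β k x)) (fun k => V k x) := by
    intro β
    have h1 : ∀ l, curvAlong (christoffel h c) F (partialAlong F β) V (partialAlong F β) l x
        = - curvCoord h c (F x) (fun k => V k x)
        (fun k => partialAlong F β k x) (fun k => partialAlong F β k x) l := fun l => by
      rw [← curvCoord_swap]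
      rfl
    simp only [innerAlong, h1, innerCoord, ← Finset.sum_neg_distrib]
    exact Finset.sum_congr rfl fun i _ => Finset.sum_congr rfl fun j _ => by ring
  have hle : ∀ β, - (K * (innerAlong (metricCoeff h c) F V V x
      * innerAlong (metricCoeff h c) F (partialAlong F β) (partialAlong F β) x
      - innerAlong (metricCoeff h c) F V (partialAlong F β) x ^ 2))
      ≤ innerAlong (metricCoeff h c) F
      (curvAlong (christoffel h c) F (partialAlong F β) V (partialAlong F β)) V x := by
    intro β
    rw [hcurv]
    exact neg_le_neg (innerCoord_curvCoord_le h hK hK0 hc hy _ _)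
  have hnn : 0 ≤ ∑ β, innerAlong (metricCoeff h c) F (covDeriv (christoffel h c) F β V)
      (covDeriv (christoffel h c) F β V) x :=
    Finset.sum_nonneg fun β _ => innerCoord_self_nonneg h hc hy
      (fun k => covDeriv (christoffel h c) F β V k x)
  have hsum := Finset.sum_le_sum fun β (_ : β ∈ Finset.univ) => hle β
  rw [Finset.sum_neg_distrib, ← Finset.mul_sum, Finset.sum_sub_distrib, ← Finset.mul_sum,
    ← normSqDifferential_eq h hf.smooth hc hx] at hsum
  rw [hcongr, P.driftLaplacian_innerAlong_radialAlong
    (fun y hy k => hf.sum_covDeriv_partialAlong hc hy k) hx,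
    radialEnergy_eq h hf.smooth hc hx]
  linarith

lemma IsSoliton.radialEnergy_eq_zero (hf : IsSoliton h f) {K : ℝ} (hK0 : 0 ≤ K)
    (hK : SectionalCurvatureLE h K) (hKe : ∀ x, K * normSqDifferential h f x ≤ 1)
    (hp : PolynomialEnergyGrowth h f) (x : Eu m) : radialEnergy h f x = 0 := by
  obtain ⟨p, hp⟩ := hp
  have hφ := radialEnergy_nonneg h f
  have hL := fun y => hf.le_driftLaplacian_radialEnergy hK0 hK (chart_mem_atlas (Eu n) (f y))
    (mem_chart_source (Eu n) (f y))
  have hL0 : driftLaplacian (radialEnergy h f) x = 0 := by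
    refine driftLaplacian_eq_zero (contDiff_radialEnergy h hf.smooth)
      (continuous_normSqDifferential h hf.smooth) hφ (normSqDifferential_nonneg h f)
      (radialEnergy_le h f) p hp (fun y => le_trans ?_ (hL y)) x
    exact add_nonneg (mul_nonneg (mul_nonneg zero_le_two (hφ y)) (sub_nonneg.2 (hKe y)))
      (mul_nonneg (mul_nonneg zero_le_two hK0) (Finset.sum_nonneg fun _ _ => sq_nonneg _))
  have hx := mem_chart_source (Eu n) (f x)
  have hc := chart_mem_atlas (Eu n) (f x)
  have h1 := hL x
  rw [hL0] at h1
  set F := fun y => chartAt (Eu n) (f x) (f y) with hF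
  have h2 : 0 ≤ 2 * radialEnergy h f x * (1 - K * normSqDifferential h f x) :=
    mul_nonneg (mul_nonneg zero_le_two (hφ x)) (sub_nonneg.2 (hKe x))
  rcases hK0.eq_or_lt with rfl | hK0
  · have := hφ x
    simp only [zero_mul, mul_zero, sub_zero, mul_one, add_zero] at h1
    linarith
  · have hsq : ∀ β, innerAlong (metricCoeff h (chartAt (Eu n) (f x))) F
        (radialAlong F) (partialAlong F β) x = 0 := by
      have hs : ∑ β, innerAlong (metricCoeff h (chartAt (Eu n) (f x))) F
          (radialAlong F) (partialAlong F β) x ^ 2 ≤ 0 := by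
        by_contra! hn
        have := mul_pos (mul_pos two_pos hK0) hn
        linarith
      intro β
      have h3 := Finset.single_le_sum (fun β _ => sq_nonneg (innerAlong
        (metricCoeff h (chartAt (Eu n) (f x))) F (radialAlong F) (partialAlong F β) x))
        (Finset.mem_univ β)
      exact pow_eq_zero_iff two_ne_zero |>.1 (le_antisymm (h3.trans hs) (sq_nonneg _))
    have P := isChartMap h hf.smooth hc
    rw [radialEnergy_eq h hf.smooth hc hx]
    -- `V = ∑ γ, (x γ / 2) ∂_γ F` is orthogonal to every `∂_γ F`, hence to itself.
    have h4 := IsChartMap.innerAlong_sum_left (G := metricCoeff h (chartAt (Eu n) (f x))) (F := F)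
      (fun γ k y => y γ / 2 * partialAlong F γ k y) (radialAlong F) x
    refine h4.trans (Finset.sum_eq_zero fun γ _ => ?_)
    rw [IsChartMap.innerAlong_mul_left (fun y => y γ / 2), P.innerAlong_comm _ (radialAlong F) hx,
      hsq, mul_zero]

/-- The curve `s ↦ e^s x` has velocity equal to its position, so `f` has zero velocity along it and
is constant there; letting `s → -∞` brings in `f 0`. -/
lemma eq_of_radialEnergy_eq_zero (hf : ContMDiff (𝓡 m) (𝓡 n) ∞ f)
    (h0 : ∀ x, radialEnergy h f x = 0) (x : Eu m) : f x = f 0 := by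
  have hd : ∀ c ∈ atlas (Eu n) N, ∀ y, f y ∈ c.source →
      fderiv ℝ (fun z => c (f z)) y y = 0 := by
    intro c hc y hy
    have h1 := h0 y
    rw [radialEnergy, inner_mfderiv h hf hc hy] at h1
    by_contra hne
    refine (innerCoord_self_pos h hc (c.map_source hy) ?_).ne' h1
    intro h2
    rw [map_smul] at h2
    refine hne ?_
    ext k
    have := congrFun h2 k
    simpa using this
  have hcurve : ∀ s : ℝ, HasDerivAt (fun s : ℝ => Real.exp s • x) (Real.exp s • x) s :=
    fun s => (Real.hasDerivAt_exp s).smul_const x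
  have hcont : Continuous fun s : ℝ => f (Real.exp s • x) :=
    hf.continuous.comp (Real.continuous_exp.smul continuous_const)
  have hloc : IsLocallyConstant fun s : ℝ => f (Real.exp s • x) := by
    refine (IsLocallyConstant.iff_eventually_eq _).2 fun s => ?_
    set c := chartAt (Eu n) (f (Real.exp s • x)) with hcdef
    have hc : c ∈ atlas (Eu n) N := chart_mem_atlas _ _
    have hs : f (Real.exp s • x) ∈ c.source := mem_chart_source _ _
    obtain ⟨ε, hε, hball⟩ := Metric.isOpen_iff.1 (c.open_source.preimage hcont) s hs
    have hder : ∀ t ∈ Metric.ball s ε, HasDerivAt (fun t : ℝ => c (f (Real.exp t • x))) 0 t := by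
      intro t ht
      have h1 := ((isChartMap h hf hc).differentiableAt_map (hball ht)).hasFDerivAt.comp_hasDerivAt
        t (hcurve t)
      rwa [hd c hc _ (hball ht)] at h1
    filter_upwards [Metric.ball_mem_nhds s hε] with t ht
    refine c.injOn (hball ht) hs ?_
    exact Metric.isOpen_ball.is_const_of_deriv_eq_zero (convex_ball s ε).isPreconnected
      (fun t ht => (hder t ht).differentiableAt.differentiableWithinAt)
      (fun t ht => (hder t ht).deriv) ht (Metric.mem_ball_self hε)
  have hconst : ∀ s : ℝ, f (Real.exp s • x) = f x := fun s => by
    have := hloc.apply_eq_of_preconnectedSpace s 0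
    simpa using this
  have hlim : Tendsto (fun s : ℝ => f (Real.exp s • x)) atBot (𝓝 (f 0)) := by
    have h1 : Tendsto (fun s : ℝ => Real.exp s • x) atBot (𝓝 0) := by
      simpa using Real.tendsto_exp_atBot.smul_const x
    exact (hf.continuous.tendsto 0).comp h1
  -- `N` is not assumed Hausdorff, so uniqueness of limits is used in a chart at `f 0`. Its domain
  -- contains `f x`, since the constant value `f x` converges to `f 0`.
  set c := chartAt (Eu n) (f 0)
  have hs0 : f 0 ∈ c.source := mem_chart_source _ _
  simp only [hconst] at hlim
  have hs : f x ∈ c.source :=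
    (eventually_const.1 (hlim.eventually_mem (c.open_source.mem_nhds hs0)))
  exact c.injOn hs hs0 (tendsto_nhds_unique tendsto_const_nhds
    ((c.continuousAt hs0).tendsto.comp hlim))

lemma polynomialEnergyGrowth_of_bounded (hf : ContMDiff (𝓡 m) (𝓡 n) ∞ f) {A : ℝ}
    (hA : ∀ x, normSqDifferential h f x ≤ A) : PolynomialEnergyGrowth h f := by
  have hA0 : 0 ≤ A := (normSqDifferential_nonneg h f 0).trans (hA 0)
  refine ⟨Polynomial.C (A * volume.real (Metric.ball (0 : Eu m) 1)) * Polynomial.X ^ m,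
    fun r hr => ?_⟩
  -- The scaling formula for ball volumes requires `0 < r`.
  rcases hr.eq_or_lt with rfl | hr
  · simp only [Metric.ball_zero, setIntegral_empty, Polynomial.eval_mul, Polynomial.eval_C,
      Polynomial.eval_pow, Polynomial.eval_X]
    positivity
  · have h1 : ∫ x in Metric.ball (0 : Eu m) r, normSqDifferential h f x
        ≤ ∫ x in Metric.ball (0 : Eu m) r, A :=
      setIntegral_mono_on (((continuous_normSqDifferential h hf).continuousOn.integrableOn_compact
        (isCompact_closedBall _ _)).mono_set Metric.ball_subset_closedBall)
        (integrableOn_const (by exact measure_ball_lt_top.ne)) measurableSet_ball fun x _ => hA x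
    refine h1.trans_eq ?_
    rw [setIntegral_const, smul_eq_mul, measureReal_def,
      Measure.addHaar_ball_of_pos volume (0 : Eu m) hr, ENNReal.toReal_mul,
      ENNReal.toReal_ofReal (by positivity), finrank_euclideanSpace_fin, ← measureReal_def]
    simp
    ring

end Soliton

end SolitonGap

end

theorem mainTheorem6 {m n : ℕ} {N : Type*} [TopologicalSpace N]
    [ChartedSpace (EuclideanSpace ℝ (Fin n)) N] [IsManifold (𝓡 n) ∞ N]
    (h : SolitonGap.RMetric n N) (f : EuclideanSpace ℝ (Fin m) → N)
    (hf : SolitonGap.IsSoliton h f) :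
    (∀ K : ℝ, 0 < K → SolitonGap.SectionalCurvatureLE h K →
      (∀ x, K * SolitonGap.normSqDifferential h f x ≤ 1) → ∃ q : N, ∀ x, f x = q) ∧
    (SolitonGap.SectionalCurvatureLE h 0 → SolitonGap.PolynomialEnergyGrowth h f →
      ∃ q : N, ∀ x, f x = q) := by
  refine ⟨fun K hK hcurv he => ⟨f 0, ?_⟩, fun hcurv hp => ⟨f 0, ?_⟩⟩
  -- The pinching gives `|Tf|² ≤ 1 / K`, so the energy of a ball grows at most like its volume.
  · have hp : SolitonGap.PolynomialEnergyGrowth h f :=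
      SolitonGap.polynomialEnergyGrowth_of_bounded hf.smooth (A := 1 / K) fun x => by
        rw [le_div_iff₀ hK, mul_comm]
        exact he x
    exact SolitonGap.eq_of_radialEnergy_eq_zero hf.smooth
      (hf.radialEnergy_eq_zero hK.le hcurv he hp)
  -- With `K = 0` the condition `K|Tf|² ≤ 1` is trivial.
  · exact SolitonGap.eq_of_radialEnergy_eq_zero hf.smooth
      (hf.radialEnergy_eq_zero le_rfl hcurv (fun x => by simp) hp)
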